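/- Let $k$ be an algebraically closed field of characteristic $p>0$, and let $n\ge 1$ and $d\ge 1$ be integers such that $p$ divides $d$. Let $\mathrm{Hyp}_d(n)=\operatorname{Proj} k[C_\alpha : \alpha\in\mathbb{N}^{n+1},\ |\alpha|=d]$ be the projective space of hypersurfaces $V(F)\subset\mathbb{P}^n_k$ of degree $d$, where $F=\sum_{|\alpha|=d}C_\alpha X^\alpha$, and let $U_{ns}\subset \mathrm{Hyp}_d(n)$ be the locus of non-singular hypersurfaces, i.e. of those $V(F)$ for which $F,\partial F/\partial X_0,\dots,\partial F/\partial X_n$ have no common zero in $\mathbb{P}^n$ over an algebraically closed field. Then $\mathrm{Hyp}_d(n)\setminus U_{ns}$ is an irreducible divisor, that is, an irreducible closed subset of codimension one, and it is the zero locus of an irreducible homogeneous polynomial $f\in k[C_\alpha]$. Moreover, some multiple of this divisor has an equation that lifts to the discriminant in characteristic zero: the discriminant $\Delta\in\mathbb{Z}[C_\alpha : |\alpha|=d]$ exists, where $\Delta$ is the irreducible polynomial (unique up to sign) which, over algebraically closed fields of characteristic zero, vanishes at exactly those nonzero forms of degree $d$ in $n+1$ variables that define a singular hypersurface; and there are an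 integer $e\ge 1$ and a constant $c\in k^\times$ such that the image of $\Delta$ in $k[C_\alpha]$ is $c f^{e}$. -/

import Mathlib

open MvPolynomial

universe u

attribute [local instance] MvPolynomial.gradedAlgebra

/-- The multi-indices `α = (α₀, …, αₙ)` with `|α| = d`. -/
abbrev DegreeExponent (n d : ℕ) : Type :=
  {α : Fin (n + 1) →₀ ℕ // α ∈ Finset.finsuppAntidiag (Finset.univ : Finset (Fin (n + 1))) d}

/-- The form `∑_{|α| = d} c_α X^α` of degree `d` in `X₀, …, Xₙ` with coefficients `c`. -/
noncomputable def formOfCoeffs {R : Type u} [CommRing R] {n d : ℕ} (c : DegreeExponent n d → R) :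
    MvPolynomial (Fin (n + 1)) R :=
  ∑ α : DegreeExponent n d, monomial α.1 (c α)

/-- The hypersurface `V(F) ⊆ ℙⁿ` over the field `K` is non-singular:
`V(F, ∂F/∂X₀, …, ∂F/∂Xₙ)` has no geometric point. -/
def IsNonsingularHypersurface {K : Type u} [Field K] {n : ℕ}
    (F : MvPolynomial (Fin (n + 1)) K) : Prop :=
  ¬ ∃ x : Fin (n + 1) → AlgebraicClosure K, x ≠ 0 ∧ aeval x F = 0 ∧
    ∀ i, aeval x (pderiv i F) = 0

/-- The projective space `Hyp_d(n) = Proj k[C_α : |α| = d]` of hypersurfaces of degree `d` in `ℙⁿ`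
over `k`, with its Zariski topology. -/
abbrev Hyp (k : Type u) [Field k] (n d : ℕ) : Type u :=
  ProjectiveSpectrum (homogeneousSubmodule (DegreeExponent n d) k)

/-- The equation of the hypersurface parametrised by a point `P` of `Hyp_d(n)`, namely the universal
form `∑ C_α X^α` with coefficients taken in the residue field of the ideal `P` of `k[C_α]`. (This is
an extension of the residue field of `P` as a point of `Proj`; the form is the base change of the
hypersurface over `P` to that extension.) -/
noncomputable def Hyp.equation {k : Type u} [Field k] {n d : ℕ} (P : Hyp k n d) :
    MvPolynomial (Fin (n + 1)) P.asHomogeneousIdeal.toIdeal.ResidueField :=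
  formOfCoeffs fun α : DegreeExponent n d =>
    algebraMap (MvPolynomial (DegreeExponent n d) k) P.asHomogeneousIdeal.toIdeal.ResidueField (X α)

/-- The locus `U_ns ⊆ Hyp_d(n)` of non-singular hypersurfaces. -/
def nonsingularLocus (k : Type u) [Field k] (n d : ℕ) : Set (Hyp k n d) :=
  {P | IsNonsingularHypersurface P.equation}

/-- An irreducible divisor: an irreducible closed subset of codimension one. The codimension is the
supremum of the lengths of chains of irreducible closed subsets that start at `Z`. -/
structure IsIrreducibleDivisor {T : Type u} [TopologicalSpace T] (Z : Set T) : Prop where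
  isIrreducible : IsIrreducible Z
  isClosed : IsClosed Z
  codim_eq_one :
    Order.coheight (⟨Z, isIrreducible, isClosed⟩ : TopologicalSpace.IrreducibleCloseds T) = 1

/-- `f` is a defining equation of the (reduced, irreducible) divisor `Z` in `Hyp_d(n)`: an
irreducible homogeneous polynomial in the coordinates `C_α` whose zero locus is `Z`. -/
structure IsDefiningEquation {k : Type u} [Field k] {n d : ℕ}
    (f : MvPolynomial (DegreeExponent n d) k) (Z : Set (Hyp k n d)) : Prop where
  irreducible : Irreducible f
  isHomogeneous : ∃ m : ℕ, f.IsHomogeneous m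
  zeroLocus_eq :
    ProjectiveSpectrum.zeroLocus (homogeneousSubmodule (DegreeExponent n d) k) {f} = Z

/-- `Δ ∈ ℤ[C_α : |α| = d]` is the discriminant of forms of degree `d` in `n + 1` variables in
characteristic zero (it is unique up to sign): it is irreducible in `ℤ[C_α]`, in particular
primitive, and over algebraically closed fields of characteristic zero it vanishes at precisely the
nonzero forms that define a singular hypersurface. -/
structure IsDiscriminant {n d : ℕ} (Δ : MvPolynomial (DegreeExponent n d) ℤ) : Prop where
  irreducible : Irreducible Δ
  aeval_eq_zero_iff : ∀ (K : Type u) [Field K] [IsAlgClosed K] [CharZero K]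
    (c : DegreeExponent n d → K), c ≠ 0 →
      (aeval c Δ = 0 ↔ ¬ IsNonsingularHypersurface (formOfCoeffs c))

/-!
A form of degree `d` singular at a point with `X i = 1` is determined by that point and by its
coefficients away from the monomials `X i ^ (d - 1) * X j`, and these can be prescribed freely. So,
over any domain `R`, the charts of the incidence variety of pairs (form, singular point) are affine
spaces, and the singular forms are the closure of the image of an irreducible variety, whose ideal
in `R[C_α]` is the kernel `I` of a map between polynomial rings. By elimination theory the image is
already closed. A cone whose vertex is its only singular point shows, again by elimination, that
the projection is generically finite; so `R[C_α] ⧸ I` has transcendence degree one less than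
`R[C_α]`, and when `R` is a UFD the prime ideal `I` is principal. This applies to `R = k`, where the
generator is the equation `f` of the divisor, and to `R = ℤ`, where it is the discriminant `Δ`.
Being zeros of `f` and of `Δ` both mean being singular, so `f` and the image of `Δ` lie in the same
primes of `k[C_α]`, and that image is `f ^ e` up to a constant.
-/

/-! ### Forms and their singular points -/

section Forms

variable {R S T : Type*} [CommRing R] [CommRing S] [CommRing T] {n d : ℕ}

theorem DegreeExponent.degree_eq (α : DegreeExponent n d) : α.1.degree = d := by
  rw [Finsupp.degree_eq_sum]
  exact (Finset.mem_finsuppAntidiag.1 α.2).1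

/-- A multi-index of total degree `d`, as an element of `DegreeExponent n d`. -/
def DegreeExponent.mk (α : Fin (n + 1) →₀ ℕ) (h : α.degree = d) : DegreeExponent n d :=
  ⟨α, Finset.mem_finsuppAntidiag.2
    ⟨by rw [← h, Finsupp.degree_eq_sum], Finset.subset_univ _⟩⟩

theorem coeff_formOfCoeffs (c : DegreeExponent n d → R) (α : DegreeExponent n d) :
    coeff α.1 (formOfCoeffs c) = c α := by
  classical
  simp [formOfCoeffs, coeff_sum, coeff_monomial]

theorem formOfCoeffs_isHomogeneous (c : DegreeExponent n d → R) :
    (formOfCoeffs c).IsHomogeneous d :=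
  IsHomogeneous.sum _ _ _ fun α _ => isHomogeneous_monomial _ α.degree_eq

theorem map_formOfCoeffs (f : R →+* S) (c : DegreeExponent n d → R) :
    map f (formOfCoeffs c) = formOfCoeffs (f ∘ c) := by
  simp [formOfCoeffs, map_monomial]

theorem formOfCoeffs_smul (t : R) (c : DegreeExponent n d → R) :
    formOfCoeffs (t • c) = C t * formOfCoeffs c := by
  simp [formOfCoeffs, Finset.mul_sum, C_mul_monomial]

theorem formOfCoeffs_coeff {F : MvPolynomial (Fin (n + 1)) R} (hF : F.IsHomogeneous d) :
    formOfCoeffs (fun α : DegreeExponent n d => coeff α.1 F) = F := by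
  ext m
  by_cases hm : m.degree = d
  · exact coeff_formOfCoeffs _ (DegreeExponent.mk m hm)
  · rw [(formOfCoeffs_isHomogeneous _).coeff_eq_zero hm, hF.coeff_eq_zero hm]

/-- `x` is a singular point of the affine cone `F = 0`. For a form `F` over an algebraically closed
field, the nonzero such `x` are the singular points of `V(F)` in projective space. -/
def IsSingularAt (F : MvPolynomial (Fin (n + 1)) R) (x : Fin (n + 1) → R) : Prop :=
  eval x F = 0 ∧ ∀ i, eval x (pderiv i F) = 0

/-- The equations of the singular locus of the affine cone `F = 0`. -/
def singularEquations (F : MvPolynomial (Fin (n + 1)) R) : Set (MvPolynomial (Fin (n + 1)) R) :=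
  insert F (Set.range fun i => pderiv i F)

theorem isSingularAt_map_iff (f : R →+* S) (F : MvPolynomial (Fin (n + 1)) R)
    (x : Fin (n + 1) → S) :
    IsSingularAt (map f F) x ↔ ∀ G ∈ singularEquations F, eval₂ f x G = 0 := by
  simp [IsSingularAt, singularEquations, pderiv_map, eval_map]

theorem IsSingularAt.map {F : MvPolynomial (Fin (n + 1)) R} {x : Fin (n + 1) → R}
    (h : IsSingularAt F x) (f : R →+* S) : IsSingularAt (MvPolynomial.map f F) (f ∘ x) := by
  simp only [IsSingularAt, pderiv_map, eval_map, ← eval₂_comp, h.1, h.2, map_zero, implies_true,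
    and_self]

theorem isHomogeneous_of_mem_singularEquations {F : MvPolynomial (Fin (n + 1)) R}
    (hF : F.IsHomogeneous d) {G : MvPolynomial (Fin (n + 1)) R} (hG : G ∈ singularEquations F) :
    ∃ m, G.IsHomogeneous m := by
  obtain rfl | ⟨i, rfl⟩ := hG
  exacts [⟨d, hF⟩, ⟨d - 1, hF.pderiv⟩]

theorem isNonsingularHypersurface_iff {K : Type u} [Field K] (F : MvPolynomial (Fin (n + 1)) K) :
    IsNonsingularHypersurface F ↔ ¬ ∃ x : Fin (n + 1) → AlgebraicClosure K, x ≠ 0 ∧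
      IsSingularAt (map (algebraMap K (AlgebraicClosure K)) F) x := by
  simp only [IsNonsingularHypersurface, IsSingularAt, pderiv_map, eval_map, aeval_def]

theorem aeval_smul_of_isHomogeneous {σ : Type*} [Algebra R T] {F : MvPolynomial σ R}
    (hF : F.IsHomogeneous d) (t : T) (x : σ → T) : aeval (t • x) F = t ^ d * aeval x F := by
  simp only [aeval_def, eval₂_eq, Finset.mul_sum, Pi.smul_apply, smul_eq_mul, mul_pow,
    Finset.prod_mul_distrib, Finset.prod_pow_eq_pow_sum]
  refine Finset.sum_congr rfl fun m hm => ?_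
  have hm' : ∑ i ∈ m.support, m i = d := by
    by_contra h
    exact mem_support_iff.1 hm (hF.coeff_eq_zero h)
  rw [hm', mul_left_comm]

theorem IsSingularAt.smul {F : MvPolynomial (Fin (n + 1)) R} (hF : F.IsHomogeneous d) (t : R)
    {x : Fin (n + 1) → R} (h : IsSingularAt F x) : IsSingularAt F (t • x) := by
  simp only [IsSingularAt, ← aeval_eq_eval] at h ⊢
  exact ⟨by simp only [aeval_smul_of_isHomogeneous hF, h.1, mul_zero],
    fun i => by simp only [aeval_smul_of_isHomogeneous hF.pderiv, h.2, mul_zero]⟩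

theorem IsSingularAt.C_mul {F : MvPolynomial (Fin (n + 1)) R} {x : Fin (n + 1) → R}
    (h : IsSingularAt F x) (t : R) : IsSingularAt (C t * F) x :=
  ⟨by rw [map_mul, h.1, mul_zero], fun i => by rw [pderiv_C_mul, map_mul, h.2 i, mul_zero]⟩

end Forms

/-! ### The generic form singular at a point of a standard affine chart -/

section Chart

variable {R S T : Type*} [CommRing R] [CommRing S] [CommRing T] {n d : ℕ}

/-- The exponent of the monomial `X i ^ d * X j`. -/
noncomputable def nearExponent (d : ℕ) (i j : Fin (n + 1)) : DegreeExponent n (d + 1) :=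
  DegreeExponent.mk (Finsupp.single i d + Finsupp.single j 1) (by simp)

theorem nearExponent_injective (i : Fin (n + 1)) :
    Function.Injective (nearExponent (n := n) d i) := fun _ _ h =>
  Finsupp.single_left_injective one_ne_zero (add_left_cancel (congrArg Subtype.val h))

/-- The exponents of degree `d + 1` of the monomials other than `X i ^ d * X j`. -/
abbrev FarExponent (n d : ℕ) (i : Fin (n + 1)) : Type :=
  {α : DegreeExponent n (d + 1) // α ∉ Set.range (nearExponent d i)}

open Classical in
/-- The splitting of the exponents of degree `d + 1` into those of the `X i ^ d * X j`, indexed by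
`j`, and the others. -/
noncomputable def exponentEquiv (n d : ℕ) (i : Fin (n + 1)) :
    Fin (n + 1) ⊕ FarExponent n d i ≃ DegreeExponent n (d + 1) :=
  (Equiv.sumCongr (Equiv.ofInjective _ (nearExponent_injective i)) (Equiv.refl _)).trans
    (Equiv.sumCompl (· ∈ Set.range (nearExponent d i)))

theorem exponentEquiv_inl (i j : Fin (n + 1)) :
    exponentEquiv n d i (Sum.inl j) = nearExponent d i j := rfl

theorem exponentEquiv_inr (i : Fin (n + 1)) (β : FarExponent n d i) :
    exponentEquiv n d i (Sum.inr β) = β := rfl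

open Classical in
/-- The form of degree `d + 1` without monomials `X i ^ d * X j` whose other coefficients are given
by `h`. -/
noncomputable def farForm (i : Fin (n + 1)) (h : FarExponent n d i → R) :
    MvPolynomial (Fin (n + 1)) R :=
  ∑ β, monomial β.1.1 (h β)

theorem farForm_isHomogeneous (i : Fin (n + 1)) (h : FarExponent n d i → R) :
    (farForm i h).IsHomogeneous (d + 1) :=
  IsHomogeneous.sum _ _ _ fun β _ => isHomogeneous_monomial _ β.1.degree_eq

theorem map_farForm (f : R →+* S) (i : Fin (n + 1)) (h : FarExponent n d i → R) :
    map f (farForm i h) = farForm i (f ∘ h) := by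
  simp [farForm, map_monomial]

theorem formOfCoeffs_eq_farForm_add (i : Fin (n + 1)) (c : DegreeExponent n (d + 1) → R) :
    formOfCoeffs c = farForm i (fun β => c β.1) +
      ∑ j, C (c (nearExponent d i j)) * (X i ^ d * X j) := by
  classical
  have hX (j : Fin (n + 1)) : C (c (nearExponent d i j)) * (X i ^ d * X j) =
      monomial (nearExponent d i j).1 (c (nearExponent d i j)) := by
    rw [X_pow_eq_monomial, X, monomial_mul, C_mul_monomial, one_mul, mul_one]
    rfl
  simp only [formOfCoeffs, ← (exponentEquiv n d i).sum_comp, Fintype.sum_sum_type,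
    exponentEquiv_inl, exponentEquiv_inr, hX, farForm, add_comm]

theorem eval_formOfCoeffs_of_eq_one {i : Fin (n + 1)} {ξ : Fin (n + 1) → R} (hξ : ξ i = 1)
    (c : DegreeExponent n (d + 1) → R) :
    eval ξ (formOfCoeffs c) = eval ξ (farForm i fun β => c β.1) +
      ∑ j, c (nearExponent d i j) * ξ j := by
  simp [formOfCoeffs_eq_farForm_add i c, hξ]

theorem eval_pderiv_formOfCoeffs_of_eq_one {i : Fin (n + 1)} {ξ : Fin (n + 1) → R}
    (hξ : ξ i = 1) (c : DegreeExponent n (d + 1) → R) (j : Fin (n + 1)) :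
    eval ξ (pderiv j (formOfCoeffs c)) = eval ξ (pderiv j (farForm i fun β => c β.1)) +
      c (nearExponent d i j) +
      if j = i then d * ∑ l, c (nearExponent d i l) * ξ l else 0 := by
  have hX (a : R) (l : Fin (n + 1)) : eval ξ (pderiv j (C a * (X i ^ d * X l))) =
      (if l = j then a else 0) + if j = i then d * (a * ξ l) else 0 := by
    rcases eq_or_ne j i with rfl | hj
    · rcases eq_or_ne l j with rfl | hl
      · simp only [Derivation.leibniz, Derivation.leibniz_pow, derivation_C, pderiv_X,
          Pi.single_eq_same, smul_eq_mul, nsmul_eq_mul, mul_zero, mul_one, one_mul, add_zero,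
          map_add, map_mul, map_pow, map_natCast, eval_C, eval_X, hξ, one_pow, if_true]
        ring
      · simp only [Derivation.leibniz, Derivation.leibniz_pow, derivation_C, pderiv_X,
          pderiv_X_of_ne hl, Pi.single_eq_same, smul_eq_mul, nsmul_eq_mul, mul_zero, mul_one,
          add_zero, zero_add, map_mul, map_pow, map_natCast, eval_C, eval_X, hξ, one_pow, if_true,
          if_neg hl]
        ring
    · rcases eq_or_ne l j with rfl | hl
      · simp [pderiv_X_of_ne hj.symm, hξ, hj]
      · simp [pderiv_X_of_ne hl, pderiv_X_of_ne hj.symm, hl, hj]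
  simp only [formOfCoeffs_eq_farForm_add i c, map_add, map_sum, hX, Finset.sum_add_distrib,
    Finset.sum_ite_eq', Finset.mem_univ, if_true, ← add_assoc]
  split_ifs <;> simp [Finset.mul_sum]

/-- The coefficient of `X i ^ d * X j` of the form singular at `ξ` whose other coefficients
are given by `h`. -/
noncomputable def nearCoeff (i : Fin (n + 1)) (h : FarExponent n d i → R) (ξ : Fin (n + 1) → R)
    (j : Fin (n + 1)) : R :=
  (if j = i then d * eval ξ (farForm i h) else 0) - eval ξ (pderiv j (farForm i h))

theorem map_nearCoeff (f : R →+* S) (i : Fin (n + 1)) (h : FarExponent n d i → R)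
    (ξ : Fin (n + 1) → R) (j : Fin (n + 1)) :
    f (nearCoeff i h ξ j) = nearCoeff i (f ∘ h) (f ∘ ξ) j := by
  simp only [nearCoeff, ← map_farForm, pderiv_map, eval_map, ← eval₂_comp, map_sub, apply_ite f,
    map_mul, map_natCast, map_zero]

theorem isSingularAt_formOfCoeffs_iff {i : Fin (n + 1)} {ξ : Fin (n + 1) → R} (hξ : ξ i = 1)
    (c : DegreeExponent n (d + 1) → R) :
    IsSingularAt (formOfCoeffs c) ξ ↔
      ∀ j, c (nearExponent d i j) = nearCoeff i (fun β => c β.1) ξ j := by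
  have euler : ∑ j, eval ξ (pderiv j (farForm i fun β => c β.1)) * ξ j =
      (d + 1) * eval ξ (farForm i fun β => c β.1) := by
    simpa [mul_comm] using
      congrArg (eval ξ) (farForm_isHomogeneous i fun β => c β.1).sum_X_mul_pderiv
  simp only [IsSingularAt, eval_formOfCoeffs_of_eq_one hξ, eval_pderiv_formOfCoeffs_of_eq_one hξ,
    nearCoeff]
  constructor
  · rintro ⟨h0, h1⟩ j
    have := h1 j
    split_ifs at this ⊢
    · linear_combination this - d * h0
    · linear_combination this
  · intro hc
    have h0 : eval ξ (farForm i fun β => c β.1) + ∑ j, c (nearExponent d i j) * ξ j = 0 := by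
      simp only [hc, sub_mul, ite_mul, zero_mul, Finset.sum_sub_distrib, Finset.sum_ite_eq',
        Finset.mem_univ, if_true, hξ, mul_one, euler]
      ring
    refine ⟨h0, fun j => ?_⟩
    have := hc j
    split_ifs at this ⊢
    · linear_combination this + d * h0
    · linear_combination this

/-- The coefficients of the form singular at `ξ`, where `ξ i = 1`, whose coefficients away from the
monomials `X i ^ d * X j` are given by `h`. -/
noncomputable def chartCoeffs (i : Fin (n + 1)) (h : FarExponent n d i → R) (ξ : Fin (n + 1) → R)
    (α : DegreeExponent n (d + 1)) : R :=
  Sum.elim (nearCoeff i h ξ) h ((exponentEquiv n d i).symm α)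

theorem chartCoeffs_nearExponent (i : Fin (n + 1)) (h : FarExponent n d i → R)
    (ξ : Fin (n + 1) → R) (j : Fin (n + 1)) :
    chartCoeffs i h ξ (nearExponent d i j) = nearCoeff i h ξ j := by
  rw [chartCoeffs, ← exponentEquiv_inl, Equiv.symm_apply_apply, Sum.elim_inl]

theorem chartCoeffs_farExponent (i : Fin (n + 1)) (h : FarExponent n d i → R)
    (ξ : Fin (n + 1) → R) (β : FarExponent n d i) : chartCoeffs i h ξ β.1 = h β := by
  rw [chartCoeffs, ← exponentEquiv_inr, Equiv.symm_apply_apply, Sum.elim_inr]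

theorem map_chartCoeffs (f : R →+* S) (i : Fin (n + 1)) (h : FarExponent n d i → R)
    (ξ : Fin (n + 1) → R) (α : DegreeExponent n (d + 1)) :
    f (chartCoeffs i h ξ α) = chartCoeffs i (f ∘ h) (f ∘ ξ) α := by
  obtain ⟨j | β, rfl⟩ := (exponentEquiv n d i).surjective α
  · simp only [exponentEquiv_inl, chartCoeffs_nearExponent, map_nearCoeff]
  · simp only [exponentEquiv_inr, chartCoeffs_farExponent, Function.comp_apply]

theorem isSingularAt_chartCoeffs {i : Fin (n + 1)} {ξ : Fin (n + 1) → R} (hξ : ξ i = 1)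
    (h : FarExponent n d i → R) : IsSingularAt (formOfCoeffs (chartCoeffs i h ξ)) ξ := by
  simp only [isSingularAt_formOfCoeffs_iff hξ, chartCoeffs_nearExponent, chartCoeffs_farExponent,
    implies_true]

theorem IsSingularAt.eq_chartCoeffs {i : Fin (n + 1)} {ξ : Fin (n + 1) → R} (hξ : ξ i = 1)
    {c : DegreeExponent n (d + 1) → R} (hc : IsSingularAt (formOfCoeffs c) ξ) :
    c = chartCoeffs i (fun β => c β.1) ξ := by
  ext α
  obtain ⟨j | β, rfl⟩ := (exponentEquiv n d i).surjective α
  · rw [exponentEquiv_inl, chartCoeffs_nearExponent, (isSingularAt_formOfCoeffs_iff hξ c).1 hc j]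
  · rw [exponentEquiv_inr, chartCoeffs_farExponent]

/-- The coordinates of the `i`-th chart of the incidence variety of pairs of a form and a
singular point of it: the affine coordinates of the point and the coefficients of the form away
from the monomials `X i ^ d * X j`. -/
abbrev ChartIndex (n d : ℕ) (i : Fin (n + 1)) : Type :=
  {j : Fin (n + 1) // j ≠ i} ⊕ FarExponent n d i

theorem card_chartIndex_add_one (n d : ℕ) (i : Fin (n + 1)) :
    Nat.card (ChartIndex n d i) + 1 = Nat.card (DegreeExponent n (d + 1)) := by
  classical
  rw [← Nat.card_congr (exponentEquiv n d i), Nat.card_sum, Nat.card_sum]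
  simp only [Nat.card_eq_fintype_card, Fintype.card_subtype_compl, Fintype.card_fin,
    Fintype.card_unique, Nat.add_sub_cancel]
  ring

variable (R d) in
open Classical in
/-- The generic point of the `i`-th standard affine chart of projective space. -/
noncomputable def chartPoint (i j : Fin (n + 1)) : MvPolynomial (ChartIndex n d i) R :=
  if hj : j = i then 1 else X (Sum.inl ⟨j, hj⟩)

theorem chartPoint_self (i : Fin (n + 1)) : chartPoint R d i i = 1 := dif_pos rfl

theorem chartPoint_ne_zero [Nontrivial R] (i j : Fin (n + 1)) : chartPoint R d i j ≠ 0 := by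
  rw [chartPoint]
  split_ifs
  exacts [one_ne_zero, X_ne_zero _]

variable (R) in
/-- The coefficients of the generic form singular at the generic point of the `i`-th chart. -/
noncomputable def genericCoeffs (d : ℕ) (i : Fin (n + 1)) :
    DegreeExponent n (d + 1) → MvPolynomial (ChartIndex n d i) R :=
  chartCoeffs i (fun β => X (Sum.inr β)) (chartPoint R d i)

theorem isSingularAt_genericCoeffs (i : Fin (n + 1)) :
    IsSingularAt (formOfCoeffs (genericCoeffs R d i)) (chartPoint R d i) :=
  isSingularAt_chartCoeffs (chartPoint_self i) _

theorem IsSingularAt.exists_specialization [Algebra R T] {i : Fin (n + 1)} {ξ : Fin (n + 1) → T}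
    (hξ : ξ i = 1) {c : DegreeExponent n (d + 1) → T} (hc : IsSingularAt (formOfCoeffs c) ξ) :
    ∃ ψ : MvPolynomial (ChartIndex n d i) R →ₐ[R] T, ψ ∘ genericCoeffs R d i = c := by
  let ψ : MvPolynomial (ChartIndex n d i) R →ₐ[R] T :=
    aeval (Sum.elim (fun j : {j : Fin (n + 1) // j ≠ i} => ξ j.1) (fun β => c β.1))
  have hpoint : ψ ∘ chartPoint R d i = ξ := by
    ext j
    rw [Function.comp_apply, chartPoint]
    split_ifs with hj
    · rw [map_one, hj, hξ]
    · simp [ψ]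
  have hfar : (ψ ∘ fun β => X (Sum.inr β)) = fun β : FarExponent n d i => c β.1 := by
    ext β
    simp [ψ]
  refine ⟨ψ, funext fun α => ?_⟩
  have := map_chartCoeffs ψ.toRingHom i (fun β => X (Sum.inr β)) (chartPoint R d i) α
  rw [hc.eq_chartCoeffs hξ]
  refine this.trans ?_
  change chartCoeffs i (ψ ∘ _) (ψ ∘ _) α = _
  rw [hfar, hpoint]

end Chart

/-! ### The discriminant ideal -/

section DiscriminantIdeal

variable {R : Type*} [CommRing R] {n d : ℕ}

variable (R) in
/-- The homomorphism of coordinate rings dual to the projection that forgets the singular point,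
from the `i`-th chart of the incidence variety to the space of forms of degree `d + 1`. -/
noncomputable def incidenceHom (d : ℕ) (i : Fin (n + 1)) :
    MvPolynomial (DegreeExponent n (d + 1)) R →ₐ[R] MvPolynomial (ChartIndex n d i) R :=
  aeval (genericCoeffs R d i)

theorem incidenceHom_X_farExponent (i : Fin (n + 1)) (β : FarExponent n d i) :
    incidenceHom R d i (X β.1) = X (Sum.inr β) := by
  rw [incidenceHom, aeval_X, genericCoeffs, chartCoeffs_farExponent]

theorem aeval_eq_zero_of_incidenceHom_eq_zero {T : Type*} [CommRing T] [Algebra R T]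
    {i : Fin (n + 1)} {ξ : Fin (n + 1) → T} (hξ : IsUnit (ξ i))
    {c : DegreeExponent n (d + 1) → T} (hc : IsSingularAt (formOfCoeffs c) ξ)
    {g : MvPolynomial (DegreeExponent n (d + 1)) R} (hg : incidenceHom R d i g = 0) :
    aeval c g = 0 := by
  obtain ⟨ψ, rfl⟩ := IsSingularAt.exists_specialization (R := R) (i := i)
    (by simp) (hc.smul (formOfCoeffs_isHomogeneous c) (↑hξ.unit⁻¹ : T))
  calc aeval (ψ ∘ genericCoeffs R d i) g = ψ (incidenceHom R d i g) :=
        (comp_aeval_apply (genericCoeffs R d i) ψ g).symm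
    _ = 0 := by rw [hg, map_zero]

variable (R n d) in
/-- The ideal of the locus of singular forms of degree `d + 1`, namely the kernel of `incidenceHom`
for the chart `X 0 = 1`; the other charts yield the same kernel when `R` is a domain. -/
noncomputable def discriminantIdeal : Ideal (MvPolynomial (DegreeExponent n (d + 1)) R) :=
  RingHom.ker (incidenceHom R d (0 : Fin (n + 1)))

instance [IsDomain R] : (discriminantIdeal R n d).IsPrime := RingHom.ker_isPrime _

theorem incidenceHom_eq_zero_of_mem [IsDomain R]
    {g : MvPolynomial (DegreeExponent n (d + 1)) R} (hg : g ∈ discriminantIdeal R n d)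
    (i : Fin (n + 1)) : incidenceHom R d i g = 0 := by
  let K := FractionRing (MvPolynomial (ChartIndex n d i) R)
  let ι : MvPolynomial (ChartIndex n d i) R →ₐ[R] K := Algebra.algHom R _ K
  have hι : Function.Injective ι := IsFractionRing.injective _ K
  have hsing := (isSingularAt_genericCoeffs (R := R) (d := d) i).map ι.toRingHom
  rw [map_formOfCoeffs] at hsing
  have hunit : IsUnit ((ι.toRingHom ∘ chartPoint R d i) 0) :=
    ((map_ne_zero_iff ι hι).2 (chartPoint_ne_zero i 0)).isUnit
  refine hι ?_
  calc ι (incidenceHom R d i g) = aeval (ι.toRingHom ∘ genericCoeffs R d i) g :=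
        comp_aeval_apply (genericCoeffs R d i) ι g
    _ = ι 0 := by rw [aeval_eq_zero_of_incidenceHom_eq_zero hunit hsing hg, map_zero]

theorem IsSingularAt.aeval_eq_zero [IsDomain R] {L : Type*} [Field L] [Algebra R L]
    {c : DegreeExponent n (d + 1) → L} {x : Fin (n + 1) → L} (hx : x ≠ 0)
    (hc : IsSingularAt (formOfCoeffs c) x) {g : MvPolynomial (DegreeExponent n (d + 1)) R}
    (hg : g ∈ discriminantIdeal R n d) : aeval c g = 0 := by
  obtain ⟨i, hi⟩ := Function.ne_iff.1 hx
  exact aeval_eq_zero_of_incidenceHom_eq_zero (Ne.isUnit hi) hc (incidenceHom_eq_zero_of_mem hg i)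

end DiscriminantIdeal

/-! ### Elimination -/

section Elimination

theorem exists_notMem_smul_eq_zero {A N : Type*} [CommRing A] [AddCommGroup N] [Module A N]
    (P : Ideal A) [P.IsPrime] {V : Submodule A N} (hV : V.FG)
    (h : ∀ v ∈ V, ∃ s ∉ P, s • v ∈ P • V) : ∃ g ∉ P, ∀ v ∈ V, g • v = 0 := by
  have : Module.Finite A V := Module.Finite.iff_fg.2 hV
  have htensor : Subsingleton (TensorProduct A P.ResidueField V) := by
    refine subsingleton_of_forall_eq 0 fun t => ?_
    induction t using TensorProduct.induction_on with
    | zero => rfl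
    | add t t' ht ht' => rw [ht, ht', add_zero]
    | tmul z v =>
      obtain ⟨s, hs, hsv⟩ := h v v.2
      let s' := algebraMap A P.ResidueField s
      have hs' : s' ≠ 0 := by rwa [Ne, Ideal.algebraMap_residueField_eq_zero]
      have tmul_eq_zero (z : P.ResidueField) {w : V} (hw : w ∈ P • (⊤ : Submodule A V)) :
          (z ⊗ₜ[A] w : TensorProduct A P.ResidueField V) = 0 := by
        induction hw using Submodule.smul_induction_on' with
        | smul p hp w =>
          rw [← TensorProduct.smul_tmul, Algebra.smul_def,
            Ideal.algebraMap_residueField_eq_zero.2 hp, zero_mul, TensorProduct.zero_tmul]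
        | add w _ w' _ hw hw' => rw [TensorProduct.tmul_add, hw, hw', add_zero]
      calc z ⊗ₜ[A] v = (s • (s'⁻¹ * z)) ⊗ₜ[A] v := by
            rw [Algebra.smul_def, mul_inv_cancel_left₀ hs']
        _ = (s'⁻¹ * z) ⊗ₜ[A] (s • v) := TensorProduct.smul_tmul _ _ _
        _ = 0 := tmul_eq_zero _ ((Submodule.mem_smul_top_iff P V _).2 hsv)
  have hsupport : (⟨P, inferInstance⟩ : PrimeSpectrum A) ∉ Module.support A V := by
    rwa [Module.mem_support_iff_nontrivial_residueField_tensorProduct,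
      not_nontrivial_iff_subsingleton]
  rw [Module.mem_support_iff_of_finite, SetLike.not_le_iff_exists] at hsupport
  obtain ⟨g, hg, hgP⟩ := hsupport
  exact ⟨g, hgP, fun v hv => congrArg Subtype.val (Module.mem_annihilator.1 hg ⟨v, hv⟩)⟩

variable {σ A D κ L : Type*} [CommRing A] [CommRing D] [IsDomain D] [Field κ] [Field L]
  [IsAlgClosed L]

theorem exists_homogeneous_mem_of_forall_zero_eq_zero [Finite σ] [Algebra κ L]
    (J : Ideal (MvPolynomial σ κ)) (hJ : ∀ x : σ → L, (∀ G ∈ J, aeval x G = 0) → x = 0) :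
    ∃ M : ℕ, ∀ F : MvPolynomial σ κ, F.IsHomogeneous M → F ∈ J := by
  have hle : idealOfVars σ κ ≤ J.radical := by
    rw [← vanishingIdeal_zeroLocus_eq_radical (K := L), idealOfVars, Ideal.span_le]
    rintro _ ⟨i, rfl⟩ x hx
    simp [hJ x hx]
  obtain ⟨M, hM⟩ := Ideal.exists_pow_le_of_le_radical_of_fg hle (idealOfVars_fg σ κ)
  refine ⟨M, fun F hF => hM ((mem_pow_idealOfVars_iff' M F).2 fun m hm => ?_)⟩
  exact hF.coeff_eq_zero hm.ne

theorem exists_C_mul_homogeneous_mem_of_forall_zero_eq_zero [Finite σ] [Algebra D L]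
    [FaithfulSMul D L] (J : Ideal (MvPolynomial σ D))
    (hJ : ∀ x : σ → L, (∀ G ∈ J, aeval x G = 0) → x = 0) :
    ∃ M : ℕ, ∀ F : MvPolynomial σ D, F.IsHomogeneous M → ∃ a ≠ 0, C a * F ∈ J := by
  let κ := FractionRing D
  let : Algebra κ L := FractionRing.liftAlgebra D L
  let : Algebra (MvPolynomial σ D) (MvPolynomial σ κ) := (map (algebraMap D κ)).toAlgebra
  have : IsLocalization ((nonZeroDivisors D).map (C (σ := σ))) (MvPolynomial σ κ) :=
    MvPolynomial.isLocalization _ _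
  have hinj : Function.Injective (map (σ := σ) (algebraMap D κ)) :=
    map_injective _ (IsFractionRing.injective D κ)
  obtain ⟨M, hM⟩ := exists_homogeneous_mem_of_forall_zero_eq_zero (L := L)
    (J.map (algebraMap (MvPolynomial σ D) (MvPolynomial σ κ))) fun x hx => hJ x fun G hG => by
      have := hx _ (Ideal.mem_map_of_mem _ hG)
      rwa [RingHom.algebraMap_toAlgebra, aeval_map_algebraMap] at this
  refine ⟨M, fun F hF => ?_⟩
  obtain ⟨⟨⟨b, hb⟩, ⟨_, a, ha, rfl⟩⟩, hab⟩ := (IsLocalization.mem_map_algebraMap_iff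
    ((nonZeroDivisors D).map (C (σ := σ))) (MvPolynomial σ κ)).1
    (hM (map (algebraMap D κ) F) (hF.map _))
  refine ⟨a, nonZeroDivisors.ne_zero ha, ?_⟩
  have : C a * F = b := hinj (by rw [mul_comm, map_mul]; exact hab)
  rwa [this]

theorem homogeneousComponent_mem_span {G : Set (MvPolynomial σ A)}
    (hG : ∀ g ∈ G, ∃ m, g.IsHomogeneous m) {F : MvPolynomial σ A}
    (hF : F ∈ Ideal.span G) (m : ℕ) : homogeneousComponent m F ∈ Ideal.span G :=
  homogeneousComponent_mem_of_mem (Ideal.homogeneous_span _ G hG) hF m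

theorem mem_smul_homogeneousSubmodule {P : Ideal A} {M : ℕ} {F : MvPolynomial σ A}
    (hF : F.IsHomogeneous M) (hP : ∀ m, coeff m F ∈ P) : F ∈ P • homogeneousSubmodule σ A M := by
  rw [F.as_sum]
  refine Submodule.sum_mem _ fun m hm => ?_
  rw [← mul_one (coeff m F), ← smul_eq_mul, ← smul_monomial]
  refine Submodule.smul_mem_smul (hP m) (isHomogeneous_monomial 1 ?_)
  by_contra h
  exact mem_support_iff.1 hm (hF.coeff_eq_zero h)

/-- Elimination over the domain `A ⧸ ker c`, lifted to `A`. -/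
theorem exists_smul_sub_mem_smul_homogeneousSubmodule [Finite σ] (c : A →+* L)
    {G : Set (MvPolynomial σ A)} (hG : ∀ g ∈ G, ∃ m, g.IsHomogeneous m)
    (hzero : ∀ x : σ → L, (∀ g ∈ G, eval₂ c x g = 0) → x = 0) :
    ∃ M : ℕ, ∀ F ∈ homogeneousSubmodule σ A M, ∃ a ∉ RingHom.ker c, ∃ H ∈ Ideal.span G,
      a • F - H ∈ RingHom.ker c • homogeneousSubmodule σ A M := by
  have := RingHom.ker_isPrime c
  let q := Ideal.Quotient.mk (RingHom.ker c)
  let : Algebra (A ⧸ RingHom.ker c) L := (RingHom.kerLift c).toAlgebra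
  have : FaithfulSMul (A ⧸ RingHom.ker c) L :=
    (faithfulSMul_iff_algebraMap_injective _ _).2 (RingHom.kerLift_injective c)
  obtain ⟨M, hM⟩ := exists_C_mul_homogeneous_mem_of_forall_zero_eq_zero (L := L)
    ((Ideal.span G).map (map q)) fun x hx => hzero x fun g hg => by
      have := hx _ (Ideal.mem_map_of_mem _ (Ideal.subset_span hg))
      rwa [aeval_def, eval₂_map] at this
  refine ⟨M, fun F hF => ?_⟩
  obtain ⟨a', ha', haF⟩ := hM (map q F) (IsHomogeneous.map hF q)
  obtain ⟨a, rfl⟩ := Ideal.Quotient.mk_surjective a'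
  obtain ⟨H, hH, hHa⟩ := (Ideal.mem_map_iff_of_surjective (map q)
    (map_surjective _ Ideal.Quotient.mk_surjective)).1 haF
  refine ⟨a, fun ha => ha' (Ideal.Quotient.eq_zero_iff_mem.2 ha), homogeneousComponent M H,
    homogeneousComponent_mem_span hG hH M, ?_⟩
  have haF : (a • F).IsHomogeneous M := Submodule.smul_mem _ a hF
  refine mem_smul_homogeneousSubmodule (haF.sub (homogeneousComponent_isHomogeneous M H))
    fun m => ?_
  have hm := congrArg (coeff m) hHa
  rw [coeff_map, coeff_C_mul, coeff_map, ← map_mul, Ideal.Quotient.eq] at hm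
  rw [coeff_sub, coeff_homogeneousComponent]
  split_ifs with hdeg
  · rw [coeff_smul, ← neg_mem_iff, neg_sub]
    exact hm
  · rw [haF.coeff_eq_zero hdeg, sub_zero]
    exact zero_mem _

/-- The main theorem of elimination theory: not having a nontrivial solution is an open condition on
the geometric point `c` of `Spec A`. -/
theorem exists_C_mul_homogeneous_mem_span [Finite σ] (c : A →+* L)
    (G : Set (MvPolynomial σ A)) (hG : ∀ g ∈ G, ∃ m, g.IsHomogeneous m)
    (hzero : ∀ x : σ → L, (∀ g ∈ G, eval₂ c x g = 0) → x = 0) :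
    ∃ (M : ℕ) (g : A), c g ≠ 0 ∧ ∀ F : MvPolynomial σ A, F.IsHomogeneous M →
      C g * F ∈ Ideal.span G := by
  obtain ⟨M, hM⟩ := exists_smul_sub_mem_smul_homogeneousSubmodule c hG hzero
  have := RingHom.ker_isPrime c
  let π : MvPolynomial σ A →ₗ[A] MvPolynomial σ A ⧸ Ideal.span G :=
    (Ideal.Quotient.mkₐ A (Ideal.span G)).toLinearMap
  have hπ {F : MvPolynomial σ A} : π F = 0 ↔ F ∈ Ideal.span G := Ideal.Quotient.eq_zero_iff_mem
  obtain ⟨g, hg, hgV⟩ := exists_notMem_smul_eq_zero (RingHom.ker c)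
    ((homogeneousSubmodule_fg σ A M).map π) (by
      rintro _ ⟨F, hF, rfl⟩
      obtain ⟨a, ha, H, hH, haF⟩ := hM F hF
      refine ⟨a, ha, ?_⟩
      have := Submodule.mem_map_of_mem (f := π) haF
      rwa [Submodule.map_smul'', map_sub, hπ.2 hH, sub_zero, map_smul] at this)
  refine ⟨M, g, hg, fun F hF => ?_⟩
  rw [C_mul', ← hπ, map_smul]
  exact hgV _ (Submodule.mem_map_of_mem hF)

end Elimination

/-! ### Singular forms are the zeros of the discriminant ideal -/

section SingularForms

variable {R : Type*} [CommRing R] {n d : ℕ}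

variable (R n d) in
/-- The universal form `∑ C_α X^α` of degree `d` in `X₀, …, Xₙ`. -/
noncomputable def universalForm :
    MvPolynomial (Fin (n + 1)) (MvPolynomial (DegreeExponent n d) R) :=
  formOfCoeffs X

theorem isHomogeneous_of_mem_singularEquations_universalForm {G}
    (hG : G ∈ singularEquations (universalForm R n d)) : ∃ m, G.IsHomogeneous m :=
  isHomogeneous_of_mem_singularEquations (formOfCoeffs_isHomogeneous _) hG

theorem isSingularAt_formOfCoeffs_iff_universalForm {T : Type*} [CommRing T] [Algebra R T]
    (c : DegreeExponent n d → T) (x : Fin (n + 1) → T) :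
    IsSingularAt (formOfCoeffs c) x ↔
      ∀ G ∈ singularEquations (universalForm R n d),
        eval₂ (aeval c : MvPolynomial (DegreeExponent n d) R →ₐ[R] T).toRingHom x G = 0 := by
  rw [← isSingularAt_map_iff, universalForm, map_formOfCoeffs]
  have : (aeval c : MvPolynomial (DegreeExponent n d) R →ₐ[R] T).toRingHom ∘ X = c :=
    funext fun α => aeval_X c α
  rw [this]

theorem exists_mem_discriminantIdeal_aeval_ne_zero {L : Type*} [Field L] [IsAlgClosed L]
    [Algebra R L] {c : DegreeExponent n (d + 1) → L}
    (hc : ∀ x, IsSingularAt (formOfCoeffs c) x → x = 0) :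
    ∃ g ∈ discriminantIdeal R n d, aeval c g ≠ 0 := by
  obtain ⟨M, g, hg, hgM⟩ := exists_C_mul_homogeneous_mem_span
    (aeval c : MvPolynomial (DegreeExponent n (d + 1)) R →ₐ[R] L).toRingHom
    (singularEquations (universalForm R n (d + 1)))
    (fun _ => isHomogeneous_of_mem_singularEquations_universalForm)
    fun x hx => hc x ((isSingularAt_formOfCoeffs_iff_universalForm c x).2 hx)
  refine ⟨g, RingHom.mem_ker.2 ?_, hg⟩
  have hle : Ideal.span (singularEquations (universalForm R n (d + 1))) ≤
      RingHom.ker (eval₂Hom (incidenceHom R d 0).toRingHom (chartPoint R d 0)) :=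
    Ideal.span_le.2 ((isSingularAt_formOfCoeffs_iff_universalForm _ _).1
      (isSingularAt_genericCoeffs 0))
  simpa [chartPoint_self] using RingHom.mem_ker.1 (hle (hgM (X 0 ^ M) (isHomogeneous_X_pow 0 M)))

theorem exists_isSingularAt_formOfCoeffs_iff [IsDomain R] {L : Type*} [Field L] [IsAlgClosed L]
    [Algebra R L] (c : DegreeExponent n (d + 1) → L) :
    (∃ x, x ≠ 0 ∧ IsSingularAt (formOfCoeffs c) x) ↔
      ∀ g ∈ discriminantIdeal R n d, aeval c g = 0 := by
  refine ⟨fun ⟨x, hx, hc⟩ g hg => hc.aeval_eq_zero hx hg, fun h => ?_⟩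
  by_contra! hc
  obtain ⟨g, hg, hcg⟩ := exists_mem_discriminantIdeal_aeval_ne_zero (R := R) (c := c)
    fun x hx => by_contra fun hx0 => hc x hx0 hx
  exact hcg (h g hg)

theorem not_isNonsingularHypersurface_formOfCoeffs_iff [IsDomain R] {K : Type u} [Field K]
    [Algebra R K] (c : DegreeExponent n (d + 1) → K) :
    ¬ IsNonsingularHypersurface (formOfCoeffs c) ↔
      ∀ g ∈ discriminantIdeal R n d, aeval c g = 0 := by
  rw [isNonsingularHypersurface_iff, not_not, map_formOfCoeffs,
    exists_isSingularAt_formOfCoeffs_iff (R := R)]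
  refine forall₂_congr fun g _ => ?_
  rw [← map_eq_zero_iff _ (algebraMap K (AlgebraicClosure K)).injective]
  exact Eq.congr_left (aeval_algebraMap_apply _ c g)

end SingularForms

/-! ### Cones with an isolated vertex -/

section Cone

variable {R : Type*} [CommRing R] {n d : ℕ}

variable (R n) in
/-- The variable `X l` for `1 ≤ l ≤ n`, and zero for other `l`. -/
noncomputable def coneVar (l : ℕ) : MvPolynomial (Fin (n + 1)) R :=
  if h : l ∈ Set.Ioo 0 (n + 1) then X ⟨l, h.2⟩ else 0

variable (R n d) in
/-- The cone `X₁ ^ (d + 1) + ∑ Xᵢ * Xᵢ₊₁ ^ d`, which does not involve `X₀`. It replaces the Fermat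
cone `∑ Xᵢ ^ (d + 1)`, all of whose points are singular, when the characteristic divides `d + 1`. -/
noncomputable def chainCone : MvPolynomial (Fin (n + 1)) R :=
  coneVar R n 1 ^ (d + 1) + ∑ l ∈ Finset.range (n + 1), coneVar R n l * coneVar R n (l + 1) ^ d

theorem coneVar_zero : coneVar R n 0 = 0 := dif_neg fun h => h.1.false

theorem coneVar_succ (j : Fin n) : coneVar R n (j + 1) = X j.succ :=
  dif_pos ⟨Nat.succ_pos _, by simp⟩

theorem coneVar_isHomogeneous (l : ℕ) : (coneVar R n l).IsHomogeneous 1 := by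
  rw [coneVar]
  split_ifs
  exacts [isHomogeneous_X _ _, isHomogeneous_zero _ _ _]

theorem chainCone_isHomogeneous : (chainCone R n d).IsHomogeneous (d + 1) := by
  refine IsHomogeneous.add ?_ (IsHomogeneous.sum _ _ _ fun l _ => ?_)
  · simpa only [one_mul] using (coneVar_isHomogeneous 1).pow (d + 1)
  · simpa only [one_mul, add_comm] using
      (coneVar_isHomogeneous l).mul ((coneVar_isHomogeneous (l + 1)).pow d)

theorem pderiv_zero_coneVar (l : ℕ) : pderiv 0 (coneVar R n l) = 0 := by
  rw [coneVar]
  split_ifs with h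
  exacts [pderiv_X_of_ne (Fin.ne_of_val_ne h.1.ne'), map_zero _]

theorem pderiv_succ_coneVar (j : Fin n) (l : ℕ) :
    pderiv j.succ (coneVar R n l) = if l = j + 1 then 1 else 0 := by
  split_ifs with hl
  · rw [hl, coneVar_succ, pderiv_X_self]
  · rw [coneVar]
    split_ifs
    exacts [pderiv_X_of_ne (Fin.ne_of_val_ne hl), map_zero _]

theorem pderiv_zero_chainCone : pderiv 0 (chainCone R n d) = 0 := by
  simp [chainCone, Derivation.leibniz, Derivation.leibniz_pow, pderiv_zero_coneVar]

theorem pderiv_succ_chainCone (hd : ((d + 1 : ℕ) : R) = 0) (j : Fin n) :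
    pderiv j.succ (chainCone R n d) =
      coneVar R n (j + 2) ^ d + d * coneVar R n j * coneVar R n (j + 1) ^ (d - 1) := by
  have hd' : ((d + 1 : ℕ) : MvPolynomial (Fin (n + 1)) R) = 0 := by
    rw [← map_natCast C, hd, map_zero]
  have hfirst : pderiv j.succ (coneVar R n 1 ^ (d + 1)) = 0 := by
    rw [Derivation.leibniz_pow, ← Nat.cast_smul_eq_nsmul (MvPolynomial (Fin (n + 1)) R), hd',
      zero_smul]
  have hterm (l : ℕ) : pderiv j.succ (coneVar R n l * coneVar R n (l + 1) ^ d) =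
      (if l = j then d * coneVar R n j * coneVar R n (j + 1) ^ (d - 1) else 0) +
        if l = j + 1 then coneVar R n (j + 2) ^ d else 0 := by
    rw [Derivation.leibniz, Derivation.leibniz_pow, pderiv_succ_coneVar, pderiv_succ_coneVar]
    obtain rfl | hl := eq_or_ne l j
    · simp only [Nat.left_eq_add, one_ne_zero, if_true, if_false,
        smul_eq_mul, nsmul_eq_mul, mul_zero, mul_one, add_zero]
      ring
    · obtain rfl | hl' := eq_or_ne l (j + 1) <;> simp [*]
  have hj : (j : ℕ) < n + 1 := j.2.trans n.lt_succ_self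
  simp only [chainCone, map_add, map_sum, hfirst, hterm, Finset.sum_add_distrib,
    Finset.sum_ite_eq', Finset.mem_range, hj, Nat.add_lt_add_iff_right, j.2, if_true]
  ring

theorem isSingularAt_chainCone (hd : d ≠ 0) (hd' : ((d + 1 : ℕ) : R) = 0) :
    IsSingularAt (chainCone R n d) (Pi.single 0 1) := by
  have hvar (l : ℕ) : eval (Pi.single 0 1) (coneVar R n l) = 0 := by
    rw [coneVar]
    split_ifs with h
    · rw [eval_X, Pi.single_eq_of_ne (Fin.ne_of_val_ne h.1.ne')]
    · exact map_zero _
  refine ⟨by simp [chainCone, hvar, hd], Fin.cases ?_ fun j => ?_⟩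
  · rw [pderiv_zero_chainCone, map_zero]
  · simp [pderiv_succ_chainCone hd', hvar, hd]

theorem eq_zero_of_isSingularAt_chainCone [IsDomain R] (hd : d ≠ 0)
    (hd' : ((d + 1 : ℕ) : R) = 0) {x : Fin (n + 1) → R}
    (hx : IsSingularAt (chainCone R n d) x) (hx0 : x 0 = 0) : x = 0 := by
  let y (l : ℕ) : R := eval x (coneVar R n l)
  have hy0 : y 0 = 0 := by simp [y, coneVar_zero]
  have hrec (j : ℕ) (hj : j < n) : y (j + 2) ^ d + d * y j * y (j + 1) ^ (d - 1) = 0 := by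
    have := hx.2 (Fin.succ ⟨j, hj⟩)
    rw [pderiv_succ_chainCone hd'] at this
    simpa using this
  have hprod (l : ℕ) (hl : l < n + 1) : y l * y (l + 1) ^ d = 0 := by
    induction l with
    | zero => rw [hy0, zero_mul]
    | succ l ih =>
      have hpow : y (l + 1) ^ (d - 1) * y (l + 1) = y (l + 1) ^ d := pow_sub_one_mul hd _
      linear_combination y (l + 1) * hrec l (Nat.succ_lt_succ_iff.1 hl) -
        d * ih (Nat.lt_of_succ_lt hl) - d * y l * hpow
  have hy1 : y 1 = 0 := by
    have hF : y 1 ^ (d + 1) + ∑ l ∈ Finset.range (n + 1), y l * y (l + 1) ^ d = 0 := by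
      simpa [chainCone, y] using hx.1
    rw [Finset.sum_eq_zero fun l hl => hprod l (Finset.mem_range.1 hl), add_zero] at hF
    exact eq_zero_of_pow_eq_zero hF
  have hy (l : ℕ) (hl : l < n + 1) : y l = 0 ∧ y (l + 1) = 0 := by
    induction l with
    | zero => exact ⟨hy0, hy1⟩
    | succ l ih =>
      obtain ⟨hyl, hyl'⟩ := ih (Nat.lt_of_succ_lt hl)
      have := hrec l (Nat.succ_lt_succ_iff.1 hl)
      rw [hyl, mul_zero, zero_mul, add_zero] at this
      exact ⟨hyl', eq_zero_of_pow_eq_zero this⟩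
  ext j
  refine Fin.cases hx0 (fun j => ?_) j
  simpa [y, coneVar_succ] using (hy j (j.2.trans n.lt_succ_self)).2

theorem isSingularAt_sum_X_succ_pow (hd : d ≠ 0) :
    IsSingularAt (∑ j : Fin n, X j.succ ^ (d + 1) : MvPolynomial (Fin (n + 1)) R)
      (Pi.single 0 1) := by
  simp [IsSingularAt, hd]

theorem eq_zero_of_isSingularAt_sum_X_succ_pow [IsDomain R] (hd : ((d + 1 : ℕ) : R) ≠ 0)
    {x : Fin (n + 1) → R}
    (hx : IsSingularAt (∑ j : Fin n, X j.succ ^ (d + 1) : MvPolynomial (Fin (n + 1)) R) x)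
    (hx0 : x 0 = 0) : x = 0 := by
  ext j
  refine Fin.cases hx0 (fun j => ?_) j
  have h : ((d + 1 : ℕ) : R) * x j.succ ^ d = 0 := by
    simpa [Pi.single_apply] using hx.2 j.succ
  exact eq_zero_of_pow_eq_zero ((mul_eq_zero.1 h).resolve_left hd)

variable (R n) in
theorem exists_isSingularAt_and_eq_zero_of_apply_zero [IsDomain R] (hd : d ≠ 0) :
    ∃ F : MvPolynomial (Fin (n + 1)) R, F.IsHomogeneous (d + 1) ∧ IsSingularAt F (Pi.single 0 1) ∧
      ∀ x, IsSingularAt F x → x 0 = 0 → x = 0 := by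
  by_cases hd' : ((d + 1 : ℕ) : R) = 0
  · exact ⟨_, chainCone_isHomogeneous, isSingularAt_chainCone hd hd',
      fun _ => eq_zero_of_isSingularAt_chainCone hd hd'⟩
  · exact ⟨_, IsHomogeneous.sum _ _ _ fun j _ => isHomogeneous_X_pow j.succ (d + 1),
      isSingularAt_sum_X_succ_pow hd, fun _ => eq_zero_of_isSingularAt_sum_X_succ_pow hd'⟩

end Cone

/-! ### The generic singular form has finitely many singular points -/

section Integrality

theorem homogeneousComponent_X_mul {σ R : Type*} [CommRing R] (i : σ) (m : ℕ)
    (q : MvPolynomial σ R) :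
    homogeneousComponent (m + 1) (X i * q) = X i * homogeneousComponent m q := by
  have := DirectSum.coe_decompose_mul_add_of_left_mem (homogeneousSubmodule σ R) (i := 1) (j := m)
    (b := q) ((mem_homogeneousSubmodule 1 _).2 (isHomogeneous_X R i))
  rw [add_comm m 1]
  refine Eq.trans ?_ (this.trans ?_)
  · exact (decomposition.decompose'_apply _ _).symm
  · exact congrArg _ (decomposition.decompose'_apply _ _)

theorem exists_isHomogeneous_sub_X_mul_mem_span {σ A : Type*} [CommRing A]
    {G : Set (MvPolynomial σ A)} (hG : ∀ g ∈ G, ∃ m, g.IsHomogeneous m) {i : σ} {m : ℕ}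
    {F : MvPolynomial σ A} (hF : F.IsHomogeneous (m + 1)) (h : F ∈ Ideal.span (insert (X i) G)) :
    ∃ q : MvPolynomial σ A, q.IsHomogeneous m ∧ F - X i * q ∈ Ideal.span G := by
  obtain ⟨q, r, hr, rfl⟩ := Ideal.mem_span_insert.1 h
  refine ⟨homogeneousComponent m q, homogeneousComponent_isHomogeneous m q, ?_⟩
  have hFr : q * X i + r - X i * homogeneousComponent m q = homogeneousComponent (m + 1) r := by
    have := homogeneousComponent_of_mem (m := m + 1) hF
    rw [if_pos rfl, map_add, mul_comm q, homogeneousComponent_X_mul] at this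
    rw [mul_comm q, ← this, add_sub_cancel_left]
  rw [hFr]
  exact homogeneousComponent_mem_span hG hr _

/-- On the chart `X i = 1`, a homogeneous system without solutions on the hyperplane `X i = 0`
defines a finite scheme; `g` is a denominator for this. -/
theorem isIntegralElem_mul_of_mem_span {σ A B : Type*} [Finite σ] [CommRing A] [CommRing B]
    [IsDomain B] (φ : A →+* B) {G : Set (MvPolynomial σ A)}
    (hG : ∀ g ∈ G, ∃ m, g.IsHomogeneous m) {i : σ} {M : ℕ} {g : A}
    (hg : ∀ F : MvPolynomial σ A, F.IsHomogeneous M → C g * F ∈ Ideal.span (insert (X i) G))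
    {ξ : σ → B} (hξ : ξ i = 1) (hzero : ∀ F ∈ G, eval₂ φ ξ F = 0) (j : σ) :
    φ.IsIntegralElem (φ g * ξ j) := by
  algebraize [φ]
  let V : Submodule A B := (homogeneousSubmodule σ A M).map (aeval ξ).toLinearMap
  have hspan : Ideal.span G ≤ RingHom.ker (aeval ξ : MvPolynomial σ A →ₐ[A] B) :=
    Ideal.span_le.2 hzero
  have hone : (1 : B) ∈ V := ⟨X i ^ M, isHomogeneous_X_pow i M, by simp [hξ]⟩
  refine isIntegral_of_smul_mem_submodule V (fun hV => one_ne_zero ((Submodule.mem_bot A).1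
    (hV ▸ hone))) ((homogeneousSubmodule_fg σ A M).map _) _ ?_
  rintro _ ⟨F, hF, rfl⟩
  have hF' : (C g * (X j * F)).IsHomogeneous (M + 1) := by
    simpa [add_comm] using (isHomogeneous_C σ g).mul ((isHomogeneous_X A j).mul hF)
  obtain ⟨q, hq, hqF⟩ := exists_isHomogeneous_sub_X_mul_mem_span hG hF'
    (by rw [mul_left_comm]; exact Ideal.mul_mem_left _ _ (hg F hF))
  refine ⟨q, hq, ?_⟩
  have : aeval ξ (C g * (X j * F) - X i * q) = 0 := hspan hqF
  simp only [map_sub, map_mul, aeval_C, aeval_X, hξ, one_mul, sub_eq_zero] at this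
  exact this.symm.trans (mul_assoc _ _ _).symm

theorem isAlgebraic_range_of_isIntegralElem_mul {R A B : Type*} [CommRing R] [CommRing A]
    [CommRing B] [IsDomain B] [Algebra R A] [Algebra R B] {φ : A →ₐ[R] B} {a : A} {b : B}
    (ha : φ a ≠ 0) (hab : φ.toRingHom.IsIntegralElem (φ a * b)) : IsAlgebraic φ.range b := by
  obtain ⟨p, hp, hpb⟩ := hab
  have hint : IsIntegral φ.range (φ.rangeRestrict a • b) :=
    ⟨p.map φ.rangeRestrict.toRingHom, hp.map _, (Polynomial.eval₂_map _ _ _).trans hpb⟩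
  exact hint.isAlgebraic.of_smul
    (mem_nonZeroDivisors_of_ne_zero fun h => ha (congrArg Subtype.val h))

end Integrality

section Algebraicity

variable {R : Type*} [CommRing R] [IsDomain R] (n : ℕ) {d : ℕ}

variable (R) in
theorem exists_incidenceHom_ne_zero (hd : d ≠ 0) :
    ∃ (M : ℕ) (g : MvPolynomial (DegreeExponent n (d + 1)) R), incidenceHom R d 0 g ≠ 0 ∧
      ∀ F : MvPolynomial (Fin (n + 1)) _, F.IsHomogeneous M →
        C g * F ∈ Ideal.span (insert (X 0) (singularEquations (universalForm R n (d + 1)))) := by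
  let L := AlgebraicClosure (FractionRing R)
  obtain ⟨F, hF, hsing, hcone⟩ := exists_isSingularAt_and_eq_zero_of_apply_zero L n hd
  let c : DegreeExponent n (d + 1) → L := fun α => coeff α.1 F
  have hc : formOfCoeffs c = F := formOfCoeffs_coeff hF
  obtain ⟨M, g, hg, hgM⟩ := exists_C_mul_homogeneous_mem_span
    (aeval c : MvPolynomial (DegreeExponent n (d + 1)) R →ₐ[R] L).toRingHom
    (insert (X 0) (singularEquations (universalForm R n (d + 1))))
    (Set.forall_mem_insert.2 ⟨⟨1, isHomogeneous_X _ 0⟩,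
      fun _ => isHomogeneous_of_mem_singularEquations_universalForm⟩) fun x hx => by
    rw [Set.forall_mem_insert, eval₂_X, ← isSingularAt_formOfCoeffs_iff_universalForm, hc] at hx
    exact hcone x hx.2 hx.1
  refine ⟨M, g, fun h => hg ?_, hgM⟩
  exact aeval_eq_zero_of_incidenceHom_eq_zero (by simp) (hc ▸ hsing) h

theorem isAlgebraic_chartPoint (hd : d ≠ 0) (j : Fin (n + 1)) :
    IsAlgebraic (incidenceHom R d (0 : Fin (n + 1))).range (chartPoint R d 0 j) := by
  obtain ⟨M, g, hg, hgM⟩ := exists_incidenceHom_ne_zero R n hd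
  refine isAlgebraic_range_of_isIntegralElem_mul hg (isIntegralElem_mul_of_mem_span _
    (fun _ => isHomogeneous_of_mem_singularEquations_universalForm) hgM (chartPoint_self 0) ?_ j)
  exact (isSingularAt_formOfCoeffs_iff_universalForm _ _).1 (isSingularAt_genericCoeffs 0)

variable (R) in
theorem isAlgebraic_range_incidenceHom (hd : d ≠ 0) :
    Algebra.IsAlgebraic (incidenceHom R d (0 : Fin (n + 1))).range
      (MvPolynomial (ChartIndex n d (0 : Fin (n + 1))) R) := by
  refine ⟨fun b => ?_⟩
  induction b using MvPolynomial.induction_on with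
  | C a => exact isAlgebraic_algebraMap (algebraMap R (incidenceHom R d 0).range a)
  | add p q hp hq => exact hp.add hq
  | mul_X p j hp =>
    refine hp.mul ?_
    obtain j | β := j
    · simpa [chartPoint, j.2] using isAlgebraic_chartPoint (R := R) n hd j.1
    · rw [← incidenceHom_X_farExponent]
      exact isAlgebraic_algebraMap ((incidenceHom R d 0).rangeRestrict (X β.1))

theorem trdeg_quotient_discriminantIdeal_add_one (hd : d ≠ 0) :
    Algebra.trdeg R (MvPolynomial (DegreeExponent n (d + 1)) R ⧸ discriminantIdeal R n d) + 1 =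
      Algebra.trdeg R (MvPolynomial (DegreeExponent n (d + 1)) R) := by
  have := isAlgebraic_range_incidenceHom R n hd
  calc Algebra.trdeg R (MvPolynomial (DegreeExponent n (d + 1)) R ⧸ discriminantIdeal R n d) + 1
    _ = Algebra.trdeg R (incidenceHom R d (0 : Fin (n + 1))).range + 1 :=
      congrArg (· + 1) (Ideal.quotientKerEquivRange _).trdeg_eq
    _ = Algebra.trdeg R (MvPolynomial (ChartIndex n d (0 : Fin (n + 1))) R) + 1 := by
      rw [← trdeg_add_eq R (incidenceHom R d (0 : Fin (n + 1))).range
        (A := MvPolynomial (ChartIndex n d (0 : Fin (n + 1))) R),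
        trdeg_eq_zero (R := (incidenceHom R d 0).range), add_zero]
    _ = Algebra.trdeg R (MvPolynomial (DegreeExponent n (d + 1)) R) := by
      rw [trdeg_of_isDomain, trdeg_of_isDomain, ← Nat.cast_card, ← Nat.cast_card,
        ← card_chartIndex_add_one n d 0, Nat.cast_succ, Cardinal.lift_add, Cardinal.lift_one]

end Algebraicity

/-! ### Prime ideals of codimension one are principal -/

section Codimension

universe v

variable {R : Type*} [CommRing R]

theorem trdeg_lt_of_surjective_of_not_injective {A B : Type v} [CommRing A] [IsDomain A]
    [CommRing B] [IsDomain B] [Algebra R A] [Algebra R B] [FaithfulSMul R B]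
    (hA : Algebra.trdeg R A < Cardinal.aleph0) {f : A →ₐ[R] B} (hf : Function.Surjective f)
    (hf' : ¬ Function.Injective f) : Algebra.trdeg R B < Algebra.trdeg R A := by
  by_contra! hle
  have : Nontrivial R := Module.nontrivial R B
  obtain ⟨s, hs⟩ := exists_isTranscendenceBasis R B
  choose g hg using hf
  have hfg : (f ∘ fun x : s => g x) = Subtype.val := funext fun x => hg x
  have hind : AlgebraicIndependent R fun x : s => g x :=
    .of_comp f (by rw [hfg]; exact hs.1)
  have hbasis : IsTranscendenceBasis R fun x : s => g x :=
    hind.isTranscendenceBasis_of_trdeg_le hA (hle.trans_eq hs.cardinalMk_eq_trdeg.symm)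
  have := hbasis.isAlgebraic
  obtain ⟨a, ha, ha0⟩ : ∃ a, f a = 0 ∧ a ≠ 0 := by
    simpa [injective_iff_map_eq_zero] using hf'
  refine Ideal.comap_ne_bot_of_algebraic_mem (I := RingHom.ker f) ha0 ha
    (Algebra.IsAlgebraic.isAlgebraic (R := Algebra.adjoin R (Set.range fun x : s => g x)) a)
    ((Submodule.eq_bot_iff _).2 ?_)
  rintro ⟨b, hb⟩ hfb
  rw [Algebra.adjoin_range_eq_range_aeval] at hb
  obtain ⟨q, rfl⟩ := hb
  have hq : aeval Subtype.val q = 0 := by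
    rw [← hfg]
    exact (comp_aeval_apply _ f q).symm.trans hfb
  exact Subtype.ext (by simp [hs.1.eq_zero_of_aeval_eq_zero q hq])

theorem exists_prime_and_eq_span_of_trdeg_quotient_add_one_eq {A : Type*} [CommRing A] [IsDomain A]
    [UniqueFactorizationMonoid A] [Algebra R A] (hA : Algebra.trdeg R A < Cardinal.aleph0)
    (P : Ideal A) [P.IsPrime] [FaithfulSMul R (A ⧸ P)]
    (hP : Algebra.trdeg R (A ⧸ P) + 1 = Algebra.trdeg R A) :
    ∃ f : A, Prime f ∧ P = Ideal.span {f} := by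
  have hP0 : P ≠ ⊥ := by
    rintro rfl
    obtain ⟨m, hm⟩ := Cardinal.lt_aleph0.1 hA
    rw [(AlgEquiv.ofRingEquiv (f := RingEquiv.quotientBot A) fun _ => rfl).trdeg_eq, hm] at hP
    exact m.succ_ne_self (mod_cast hP)
  obtain ⟨f, hfP, hf⟩ := Ideal.IsPrime.exists_mem_prime_of_ne_bot ‹_› hP0
  have hle : Ideal.span {f} ≤ P := (Ideal.span_singleton_le_iff_mem P).2 hfP
  have := (Ideal.span_singleton_prime hf.ne_zero).2 hf
  have : FaithfulSMul R (A ⧸ Ideal.span {f}) := by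
    refine (faithfulSMul_iff_algebraMap_injective R _).2
      (.of_comp (f := Ideal.Quotient.factor hle) ?_)
    exact FaithfulSMul.algebraMap_injective R (A ⧸ P)
  refine ⟨f, hf, (hle.antisymm fun a ha => by_contra fun haf => ?_).symm⟩
  have h₁ : Algebra.trdeg R (A ⧸ Ideal.span {f}) < Algebra.trdeg R A :=
    trdeg_lt_of_surjective_of_not_injective hA (Ideal.Quotient.mkₐ_surjective R (Ideal.span {f}))
      fun h => hf.ne_zero (h (by simp))
  have h₂ : Algebra.trdeg R (A ⧸ P) < Algebra.trdeg R (A ⧸ Ideal.span {f}) :=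
    trdeg_lt_of_surjective_of_not_injective (h₁.trans hA)
      (f := Ideal.Quotient.factorₐ R hle) (Ideal.Quotient.factor_surjective hle)
      fun h => haf ?_
  · exact (Cardinal.add_one_le_of_lt h₂).not_gt (hP ▸ h₁)
  · rw [← Ideal.Quotient.eq_zero_iff_mem] at ha ⊢
    exact h (by simpa using ha)

theorem exists_prime_and_discriminantIdeal_eq_span (R : Type*) [CommRing R] [IsDomain R]
    [UniqueFactorizationMonoid R] (n : ℕ) {d : ℕ} (hd : d ≠ 0) :
    ∃ f, Prime f ∧ discriminantIdeal R n d = Ideal.span {f} := by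
  have : FaithfulSMul R (MvPolynomial (DegreeExponent n (d + 1)) R ⧸ discriminantIdeal R n d) :=
    (faithfulSMul_iff_algebraMap_injective R _).2
      (.of_comp (f := Ideal.kerLiftAlg (incidenceHom R d 0)) fun r s h => C_injective _ R
        (((Ideal.kerLiftAlg _).commutes r).symm.trans (h.trans ((Ideal.kerLiftAlg _).commutes s))))
  exact exists_prime_and_eq_span_of_trdeg_quotient_add_one_eq trdeg_lt_aleph0_of_finiteType _
    (trdeg_quotient_discriminantIdeal_add_one n hd)

end Codimension

/-! ### The discriminant ideal is homogeneous -/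

section Homogeneity

variable {R : Type*} [CommRing R]

theorem coeff_aeval_X_smul {σ B : Type*} [CommRing B] [Algebra R B] (F : MvPolynomial σ R)
    (x : σ → B) (N : ℕ) :
    (aeval ((Polynomial.X : Polynomial B) • (Polynomial.C ∘ x)) F).coeff N =
      aeval x (homogeneousComponent N F) := by
  induction F using MvPolynomial.induction_on' with
  | monomial m a =>
    have hm : (monomial m a).IsHomogeneous m.degree := isHomogeneous_monomial a rfl
    have hC : aeval (Polynomial.C ∘ x) (monomial m a) = Polynomial.C (aeval x (monomial m a)) :=
      (comp_aeval_apply x (Polynomial.CAlgHom (R := R) (A := B)) _).symm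
    rw [aeval_smul_of_isHomogeneous hm, hC, homogeneousComponent_of_mem hm,
      Polynomial.coeff_X_pow_mul', Polynomial.coeff_C]
    split_ifs with h₁ h₂ h₃ <;> first | rfl | (exact (map_zero _).symm) | omega
  | add p q hp hq => simp only [map_add, Polynomial.coeff_add, hp, hq]

theorem discriminantIdeal_isHomogeneous (R : Type*) [CommRing R] (n d : ℕ) :
    (discriminantIdeal R n d).IsHomogeneous
      (homogeneousSubmodule (DegreeExponent n (d + 1)) R) := by
  intro N g hg
  let B := MvPolynomial (ChartIndex n d 0) R
  let c := genericCoeffs R d (0 : Fin (n + 1))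
  let x := chartPoint R d (0 : Fin (n + 1))
  have hsing : IsSingularAt (formOfCoeffs ((Polynomial.X : Polynomial B) • (Polynomial.C ∘ c)))
      (Polynomial.C ∘ x) := by
    rw [formOfCoeffs_smul, ← map_formOfCoeffs]
    exact ((isSingularAt_genericCoeffs 0).map Polynomial.C).C_mul _
  have hx : IsUnit ((Polynomial.C ∘ x) 0) := by simp [x, chartPoint_self]
  calc aeval c (DirectSum.decompose (homogeneousSubmodule _ R) g N : MvPolynomial _ R)
    _ = aeval c (homogeneousComponent N g) := congrArg _ (decomposition.decompose'_apply g N)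
    _ = 0 := by
      rw [← coeff_aeval_X_smul, aeval_eq_zero_of_incidenceHom_eq_zero hx hsing hg,
        Polynomial.coeff_zero]

theorem exists_isHomogeneous_of_isHomogeneous_span [IsDomain R] {σ : Type*} {f : MvPolynomial σ R}
    (hf : (Ideal.span {f}).IsHomogeneous (homogeneousSubmodule σ R)) : ∃ N, f.IsHomogeneous N := by
  rcases eq_or_ne f 0 with rfl | hf0
  · exact ⟨0, isHomogeneous_zero _ _ _⟩
  have htop : homogeneousComponent f.totalDegree f ≠ 0 := by
    obtain ⟨m, hm, hdeg : f.totalDegree = m.degree⟩ :=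
      Finset.exists_mem_eq_sup f.support (support_nonempty.2 hf0) Finsupp.degree
    refine ne_zero_iff.2 ⟨m, ?_⟩
    rwa [coeff_homogeneousComponent, if_pos hdeg.symm, ← mem_support_iff]
  obtain ⟨q, hq⟩ := Ideal.mem_span_singleton.1
    (homogeneousComponent_mem_of_mem hf (Ideal.mem_span_singleton_self f) f.totalDegree)
  have hhom := homogeneousComponent_isHomogeneous f.totalDegree f
  have hq0 : q ≠ 0 := right_ne_zero_of_mul (hq ▸ htop)
  have hdeg : q.totalDegree = 0 := by
    have := hhom.totalDegree htop
    rw [hq, totalDegree_mul_of_isDomain hf0 hq0] at this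
    omega
  obtain ⟨a, rfl⟩ : ∃ a, q = C a := ⟨_, totalDegree_eq_zero_iff_eq_C.1 hdeg⟩
  refine ⟨f.totalDegree, fun m hm => hhom (d := m) ?_⟩
  rw [hq, mul_comm, coeff_C_mul]
  exact mul_ne_zero (C_ne_zero.1 hq0) hm

end Homogeneity

/-! ### Irreducible divisors in projective spectra -/

section ProjectiveSpectrum

theorem isIrreducibleDivisor_of_forall_ssubset_eq_univ {T : Type u} [TopologicalSpace T]
    [IrreducibleSpace T] {Z : Set T} (hirr : IsIrreducible Z) (hcl : IsClosed Z)
    (hne : Z ≠ Set.univ)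
    (hmax : ∀ W : Set T, IsIrreducible W → IsClosed W → Z ⊂ W → W = Set.univ) :
    IsIrreducibleDivisor Z := by
  let Z' : TopologicalSpace.IrreducibleCloseds T := ⟨Z, hirr, hcl⟩
  let V : TopologicalSpace.IrreducibleCloseds T :=
    ⟨Set.univ, IrreducibleSpace.isIrreducible_univ T, isClosed_univ⟩
  have hV : ∀ W > Z', W = V := fun W hW =>
    TopologicalSpace.IrreducibleCloseds.ext (hmax W W.isIrreducible W.isClosed hW)
  have hVmax : IsMax V := fun W _ => Set.subset_univ (W : Set T)
  refine ⟨hirr, hcl, le_antisymm ?_ ?_⟩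
  · refine (Order.coheight_le_coe_iff (n := 1)).2 fun W hW => ?_
    rw [hV W hW, Order.coheight_eq_zero.2 hVmax]
    exact zero_lt_one
  · rw [Order.one_le_iff_ne_zero, Order.coheight_ne_zero]
    intro hZ'
    have hVZ : V ≤ Z' := hZ' (Set.subset_univ Z)
    exact hne (Set.univ_subset_iff.1 hVZ)

variable {A : Type u} {τ : Type*} [CommRing A] [SetLike τ A] [AddSubgroupClass τ A] {𝒜 : ℕ → τ}
  [GradedRing 𝒜]

theorem exists_projectiveSpectrum_toIdeal_eq {I : Ideal A} [I.IsPrime] (hI : I.IsHomogeneous 𝒜)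
    (hirrel : ¬ (HomogeneousIdeal.irrelevant 𝒜).toIdeal ≤ I) :
    ∃ P : ProjectiveSpectrum 𝒜, P.asHomogeneousIdeal.toIdeal = I :=
  ⟨⟨⟨I, hI⟩, inferInstance, hirrel⟩, rfl⟩

theorem isIrreducible_zeroLocus {I : Ideal A} [I.IsPrime] (hI : I.IsHomogeneous 𝒜)
    (hirrel : ¬ (HomogeneousIdeal.irrelevant 𝒜).toIdeal ≤ I) :
    IsIrreducible (ProjectiveSpectrum.zeroLocus 𝒜 (I : Set A)) := by
  obtain ⟨P, rfl⟩ := exists_projectiveSpectrum_toIdeal_eq hI hirrel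
  have : closure {P} =
      ProjectiveSpectrum.zeroLocus 𝒜 (P.asHomogeneousIdeal.toIdeal : Set A) := by
    rw [← ProjectiveSpectrum.zeroLocus_vanishingIdeal_eq_closure,
      ProjectiveSpectrum.vanishingIdeal_singleton]
    rfl
  exact this ▸ isIrreducible_singleton.closure

theorem subset_zeroLocus_singleton_iff {W : Set (ProjectiveSpectrum 𝒜)} {a : A} :
    W ⊆ ProjectiveSpectrum.zeroLocus 𝒜 {a} ↔
      a ∈ (ProjectiveSpectrum.vanishingIdeal W).toIdeal := by
  rw [ProjectiveSpectrum.subset_zeroLocus_iff_subset_vanishingIdeal, Set.singleton_subset_iff]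
  rfl

theorem isPrime_vanishingIdeal {W : Set (ProjectiveSpectrum 𝒜)} (hW : IsIrreducible W) :
    (ProjectiveSpectrum.vanishingIdeal W).toIdeal.IsPrime := by
  refine ⟨(Ideal.ne_top_iff_one _).2 fun h => ?_, fun {a b} hab => ?_⟩
  · rw [← subset_zeroLocus_singleton_iff, ProjectiveSpectrum.zeroLocus_singleton_one] at h
    exact hW.nonempty.ne_empty (Set.subset_empty_iff.1 h)
  · rw [← subset_zeroLocus_singleton_iff, ProjectiveSpectrum.zeroLocus_singleton_mul] at hab
    rw [← subset_zeroLocus_singleton_iff, ← subset_zeroLocus_singleton_iff]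
    exact isPreirreducible_iff_isClosed_union_isClosed.1 hW.2 _ _
      (ProjectiveSpectrum.isClosed_zeroLocus _ _) (ProjectiveSpectrum.isClosed_zeroLocus _ _) hab

theorem eq_bot_of_le_span_singleton_of_notMem [IsDomain A] [UniqueFactorizationMonoid A] {f : A}
    (hf : Prime f) {Q : Ideal A} [Q.IsPrime] (hle : Q ≤ Ideal.span {f}) (hfQ : f ∉ Q) :
    Q = ⊥ := by
  by_contra hQ
  obtain ⟨q, hqQ, hq⟩ := Ideal.IsPrime.exists_mem_prime_of_ne_bot ‹Q.IsPrime› hQ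
  have hfq : Associated f q :=
    hf.irreducible.associated_of_dvd hq.irreducible (Ideal.mem_span_singleton.1 (hle hqQ))
  exact hfQ (Q.mem_of_dvd hfq.symm.dvd hqQ)

theorem dvd_of_zeroLocus_subset {f g : A} (hf : Prime f) (hom : (Ideal.span {f}).IsHomogeneous 𝒜)
    (hirrel : ¬ (HomogeneousIdeal.irrelevant 𝒜).toIdeal ≤ Ideal.span {f})
    (h : ProjectiveSpectrum.zeroLocus 𝒜 {f} ⊆ ProjectiveSpectrum.zeroLocus 𝒜 {g}) : f ∣ g := by
  have : (Ideal.span {f}).IsPrime := (Ideal.span_singleton_prime hf.ne_zero).2 hf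
  obtain ⟨P, hP⟩ := exists_projectiveSpectrum_toIdeal_eq hom hirrel
  have hfP : f ∈ P.asHomogeneousIdeal.toIdeal := hP ▸ Ideal.mem_span_singleton_self f
  have hgP : g ∈ P.asHomogeneousIdeal.toIdeal := h (Set.singleton_subset_iff.2 hfP) rfl
  exact Ideal.mem_span_singleton.1 (hP ▸ hgP)

theorem eq_univ_of_zeroLocus_singleton_ssubset [IsDomain A] [UniqueFactorizationMonoid A] {f : A}
    (hf : Prime f) (hom : (Ideal.span {f}).IsHomogeneous 𝒜)
    (hirrel : ¬ (HomogeneousIdeal.irrelevant 𝒜).toIdeal ≤ Ideal.span {f})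
    {W : Set (ProjectiveSpectrum 𝒜)} (hW : IsIrreducible W) (hWcl : IsClosed W)
    (hlt : ProjectiveSpectrum.zeroLocus 𝒜 {f} ⊂ W) : W = Set.univ := by
  let Q := (ProjectiveSpectrum.vanishingIdeal W).toIdeal
  have : Q.IsPrime := isPrime_vanishingIdeal hW
  have hQf : Q ≤ Ideal.span {f} := fun g hg => Ideal.mem_span_singleton.2
    (dvd_of_zeroLocus_subset hf hom hirrel (hlt.1.trans (subset_zeroLocus_singleton_iff.2 hg)))
  have hfQ : f ∉ Q := fun h => hlt.2 (subset_zeroLocus_singleton_iff.2 h)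
  have hQ : Q = ⊥ := eq_bot_of_le_span_singleton_of_notMem hf hQf hfQ
  calc W = ProjectiveSpectrum.zeroLocus 𝒜 (Q : Set A) :=
        hWcl.closure_eq.symm.trans (ProjectiveSpectrum.zeroLocus_vanishingIdeal_eq_closure 𝒜 W).symm
    _ = Set.univ := by rw [hQ, ProjectiveSpectrum.zeroLocus_bot]

theorem isIrreducibleDivisor_zeroLocus [IsDomain A] [UniqueFactorizationMonoid A] {f : A}
    (hf : Prime f) (hom : (Ideal.span {f}).IsHomogeneous 𝒜)
    (hirrel : ¬ (HomogeneousIdeal.irrelevant 𝒜).toIdeal ≤ Ideal.span {f}) :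
    IsIrreducibleDivisor (ProjectiveSpectrum.zeroLocus 𝒜 {f}) := by
  have : (Ideal.span {f}).IsPrime := (Ideal.span_singleton_prime hf.ne_zero).2 hf
  have hbot := Ideal.IsHomogeneous.bot 𝒜
  have hirrel₀ : ¬ (HomogeneousIdeal.irrelevant 𝒜).toIdeal ≤ ⊥ := fun h => hirrel (h.trans bot_le)
  have : IrreducibleSpace (ProjectiveSpectrum 𝒜) := by
    rw [irreducibleSpace_def, Set.top_eq_univ, ← ProjectiveSpectrum.zeroLocus_bot]
    exact isIrreducible_zeroLocus hbot hirrel₀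
  have hne : ProjectiveSpectrum.zeroLocus 𝒜 {f} ≠ Set.univ := fun h => by
    obtain ⟨P, hP⟩ := exists_projectiveSpectrum_toIdeal_eq hbot hirrel₀
    have hfP : f ∈ P.asHomogeneousIdeal.toIdeal := Set.eq_univ_iff_forall.1 h P rfl
    exact hf.ne_zero (Ideal.mem_bot.1 (hP ▸ hfP))
  exact isIrreducibleDivisor_of_forall_ssubset_eq_univ
    (ProjectiveSpectrum.zeroLocus_span 𝒜 {f} ▸ isIrreducible_zeroLocus hom hirrel)
    (ProjectiveSpectrum.isClosed_zeroLocus _ _) hne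
    fun _ => eq_univ_of_zeroLocus_singleton_ssubset hf hom hirrel

end ProjectiveSpectrum

/-! ### The discriminant -/

section Discriminant

theorem nontrivial_degreeExponent {n : ℕ} (hn : 1 ≤ n) (d : ℕ) :
    Nontrivial (DegreeExponent n (d + 1)) :=
  have : Nontrivial (Fin (n + 1)) := Fin.nontrivial_iff_two_le.2 (Nat.succ_le_succ hn)
  (nearExponent_injective 0).nontrivial

theorem exists_not_dvd_X {σ R : Type*} [CommRing R] [IsDomain R] [Nontrivial σ]
    {f : MvPolynomial σ R} (hf : Prime f) : ∃ s, ¬ f ∣ X s := by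
  by_contra! hdvd
  obtain ⟨s, t, hst⟩ := exists_pair_ne σ
  have hsf : X s ∣ f := hf.irreducible.dvd_symm (X_prime (R := R)).irreducible (hdvd s)
  exact hst (X_dvd_X.1 (hsf.trans (hdvd t)))

theorem not_irrelevant_le_span_singleton {σ k : Type*} [Field k] [Nontrivial σ]
    {f : MvPolynomial σ k} (hf : Prime f) :
    ¬ (HomogeneousIdeal.irrelevant (homogeneousSubmodule σ k)).toIdeal ≤ Ideal.span {f} := by
  intro h
  obtain ⟨s, hs⟩ := exists_not_dvd_X hf
  exact hs (Ideal.mem_span_singleton.1 (h (HomogeneousIdeal.mem_irrelevant_of_mem _ one_pos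
    (isHomogeneous_X k s))))

theorem exists_associated_pow_of_forall_mem_iff_mem {A : Type*} [CommRing A] [IsDomain A] {f g : A}
    (hf : Prime f) (h : ∀ P : Ideal A, P.IsPrime → (g ∈ P ↔ f ∈ P)) :
    ∃ e ≠ 0, Associated g (f ^ e) := by
  have hfg : f ∈ (Ideal.span {g}).radical := by
    rw [Ideal.radical_eq_sInf, Ideal.mem_sInf]
    exact fun {P} hP => (h P hP.2).1 (hP.1 (Ideal.mem_span_singleton_self g))
  obtain ⟨N, hN⟩ := hfg
  obtain ⟨e, -, he⟩ := (dvd_prime_pow hf N).1 (Ideal.mem_span_singleton.1 hN)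
  refine ⟨e, ?_, he⟩
  rintro rfl
  have hgf : f ∣ g := Ideal.mem_span_singleton.1
    ((h _ ((Ideal.span_singleton_prime hf.ne_zero).2 hf)).2 (Ideal.mem_span_singleton_self f))
  rw [pow_zero, associated_one_iff_isUnit] at he
  exact hf.not_isUnit (isUnit_of_dvd_unit hgf he)

variable {R : Type*} [CommRing R] [IsDomain R] {n d : ℕ}
  {Δ : MvPolynomial (DegreeExponent n (d + 1)) R}

theorem aeval_eq_zero_iff_not_isNonsingularHypersurface
    (hΔ : discriminantIdeal R n d = Ideal.span {Δ}) {K : Type u} [Field K] [Algebra R K]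
    (c : DegreeExponent n (d + 1) → K) :
    aeval c Δ = 0 ↔ ¬ IsNonsingularHypersurface (formOfCoeffs c) := by
  rw [not_isNonsingularHypersurface_formOfCoeffs_iff (R := R), hΔ]
  refine ⟨fun h g hg => ?_, fun h => h Δ (Ideal.mem_span_singleton_self Δ)⟩
  obtain ⟨q, rfl⟩ := Ideal.mem_span_singleton.1 hg
  rw [map_mul, h, zero_mul]

variable {k : Type u} [Field k] {f : MvPolynomial (DegreeExponent n (d + 1)) k}

theorem map_mem_iff_not_isNonsingularHypersurface [Algebra R k]
    (hΔ : discriminantIdeal R n d = Ideal.span {Δ})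
    (P : Ideal (MvPolynomial (DegreeExponent n (d + 1)) k)) [P.IsPrime] :
    map (algebraMap R k) Δ ∈ P ↔ ¬ IsNonsingularHypersurface (formOfCoeffs fun α =>
      algebraMap (MvPolynomial (DegreeExponent n (d + 1)) k) P.ResidueField (X α)) := by
  let : Algebra R P.ResidueField := ((algebraMap k P.ResidueField).comp (algebraMap R k)).toAlgebra
  have : IsScalarTower R k P.ResidueField := .of_algebraMap_eq fun _ => rfl
  rw [← aeval_eq_zero_iff_not_isNonsingularHypersurface hΔ, ← aeval_map_algebraMap k,
    ← Ideal.algebraMap_residueField_eq_zero]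
  refine Eq.congr_left ?_
  calc algebraMap _ P.ResidueField (map (algebraMap R k) Δ)
    _ = algebraMap _ P.ResidueField (aeval X (map (algebraMap R k) Δ)) := by
      rw [aeval_X_left_apply]
    _ = _ := (aeval_algebraMap_apply _ _ _).symm

theorem zeroLocus_eq_compl_nonsingularLocus (hf : discriminantIdeal k n d = Ideal.span {f}) :
    ProjectiveSpectrum.zeroLocus (homogeneousSubmodule (DegreeExponent n (d + 1)) k) {f} =
      (nonsingularLocus k n (d + 1))ᶜ := by
  ext P
  rw [ProjectiveSpectrum.mem_zeroLocus, Set.singleton_subset_iff]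
  have h := map_mem_iff_not_isNonsingularHypersurface hf P.asHomogeneousIdeal.toIdeal
  rwa [Algebra.algebraMap_self, map_id] at h

theorem exists_map_eq_C_mul_pow [Algebra R k] (hf : Prime f)
    (hIf : discriminantIdeal k n d = Ideal.span {f})
    (hΔ : discriminantIdeal R n d = Ideal.span {Δ}) :
    ∃ (e : ℕ) (c : k), 1 ≤ e ∧ c ≠ 0 ∧ map (algebraMap R k) Δ = C c * f ^ e := by
  obtain ⟨e, he, u, hu⟩ := exists_associated_pow_of_forall_mem_iff_mem (A := MvPolynomial _ k) hf
    fun P _ => (map_mem_iff_not_isNonsingularHypersurface hΔ P).trans <| by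
      simpa only [Algebra.algebraMap_self, map_id] using
        (map_mem_iff_not_isNonsingularHypersurface hIf P).symm
  obtain ⟨c, hc, huc⟩ := MvPolynomial.isUnit_iff_eq_C_of_isReduced.1 (u⁻¹).isUnit
  refine ⟨e, c, Nat.one_le_iff_ne_zero.2 he, hc.ne_zero, ?_⟩
  rw [← huc, ← hu, mul_comm, Units.mul_inv_cancel_right]

theorem aeval_genericCoeffs_eq_zero_iff {K : Type*} [CommRing K]
    {ι : MvPolynomial (ChartIndex n d (0 : Fin (n + 1))) ℤ →+* K} (hι : Function.Injective ι)
    {g : MvPolynomial (DegreeExponent n (d + 1)) ℤ} :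
    aeval (ι ∘ genericCoeffs ℤ d 0) g = 0 ↔ g ∈ discriminantIdeal ℤ n d := by
  have hg : aeval (ι ∘ genericCoeffs ℤ d 0) g = ι (incidenceHom ℤ d 0 g) :=
    (comp_aeval_apply (genericCoeffs ℤ d 0) ι.toIntAlgHom g).symm
  rw [hg, map_eq_zero_iff ι hι, discriminantIdeal, RingHom.mem_ker]

variable (n d) in
theorem exists_charZero_forall_aeval_eq_zero_iff_mem_discriminantIdeal :
    ∃ (K : Type u) (_ : Field K) (_ : IsAlgClosed K) (_ : CharZero K)
      (c : DegreeExponent n (d + 1) → K),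
      ∀ g, aeval c g = 0 ↔ g ∈ discriminantIdeal ℤ n d := by
  let B := MvPolynomial (ChartIndex n d (0 : Fin (n + 1))) ℤ
  let B' := ULift.{u} B
  have : IsDomain B' := (ULift.ringEquiv (R := B)).toMulEquiv.isDomain B
  let K := AlgebraicClosure (FractionRing B')
  let ι : B →+* K := ((algebraMap (FractionRing B') K).comp (algebraMap B' (FractionRing B'))).comp
    (ULift.ringEquiv (R := B)).symm.toRingHom
  have hι : Function.Injective ι := ((algebraMap (FractionRing B') K).injective.comp
    (IsFractionRing.injective B' _)).comp (RingEquiv.injective _)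
  exact ⟨K, inferInstance, inferInstance, charZero_of_injective_ringHom hι,
    ι ∘ genericCoeffs ℤ d 0, fun g => aeval_genericCoeffs_eq_zero_iff hι⟩

theorem discriminantIdeal_eq_span_of_isDiscriminant (hn : 1 ≤ n)
    {Δ₀ Δ : MvPolynomial (DegreeExponent n (d + 1)) ℤ} (hΔ₀ : Prime Δ₀)
    (hI : discriminantIdeal ℤ n d = Ideal.span {Δ₀}) (hΔ : IsDiscriminant.{u} Δ) :
    discriminantIdeal ℤ n d = Ideal.span {Δ} := by
  obtain ⟨K, _, _, _, c, hc⟩ :=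
    exists_charZero_forall_aeval_eq_zero_iff_mem_discriminantIdeal.{u} n d
  have := nontrivial_degreeExponent hn d
  obtain ⟨α, hα⟩ := exists_not_dvd_X hΔ₀
  have hc0 : c ≠ 0 := fun h => by
    have hX : X α ∈ discriminantIdeal ℤ n d := by rw [← hc, aeval_X, h, Pi.zero_apply]
    exact hα (Ideal.mem_span_singleton.1 (hI ▸ hX))
  have hmem : Δ ∈ discriminantIdeal ℤ n d := by
    rw [← hc, hΔ.aeval_eq_zero_iff K c hc0, not_isNonsingularHypersurface_formOfCoeffs_iff (R := ℤ)]
    exact fun g hg => (hc g).2 hg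
  rw [hI, Ideal.mem_span_singleton] at hmem
  rw [hI, Ideal.span_singleton_eq_span_singleton]
  exact hΔ₀.irreducible.associated_of_dvd hΔ.irreducible hmem

theorem discriminantIdeal_eq_span_of_isDefiningEquation (hn : 1 ≤ n)
    {f₀ : MvPolynomial (DegreeExponent n (d + 1)) k} (hf₀ : Prime f₀)
    (hI : discriminantIdeal k n d = Ideal.span {f₀})
    (hf : IsDefiningEquation f (nonsingularLocus k n (d + 1))ᶜ) :
    discriminantIdeal k n d = Ideal.span {f} := by
  have := nontrivial_degreeExponent hn d
  have hdvd : f₀ ∣ f := dvd_of_zeroLocus_subset hf₀ (hI ▸ discriminantIdeal_isHomogeneous k n d)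
    (not_irrelevant_le_span_singleton hf₀)
    ((zeroLocus_eq_compl_nonsingularLocus hI).trans hf.zeroLocus_eq.symm).subset
  rw [hI, Ideal.span_singleton_eq_span_singleton]
  exact hf₀.irreducible.associated_of_dvd hf.irreducible hdvd

end Discriminant

theorem theorem3p3_general {k : Type u} [Field k] (n d : ℕ) (hn : 1 ≤ n) (hd : 2 ≤ d) :
    IsIrreducibleDivisor (nonsingularLocus k n d)ᶜ ∧
    (∃ f : MvPolynomial (DegreeExponent n d) k,
      IsDefiningEquation f (nonsingularLocus k n d)ᶜ) ∧
    (∃ Δ : MvPolynomial (DegreeExponent n d) ℤ, IsDiscriminant.{u} Δ) ∧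
    ∀ (f : MvPolynomial (DegreeExponent n d) k) (Δ : MvPolynomial (DegreeExponent n d) ℤ),
      IsDefiningEquation f (nonsingularLocus k n d)ᶜ → IsDiscriminant.{u} Δ →
        ∃ (e : ℕ) (c : k), 1 ≤ e ∧ c ≠ 0 ∧
          MvPolynomial.map (Int.castRingHom k) Δ = MvPolynomial.C c * f ^ e := by
  obtain ⟨d, rfl⟩ : ∃ d', d = d' + 1 := ⟨d - 1, by omega⟩
  replace hd : d ≠ 0 := by omega
  have := nontrivial_degreeExponent hn d
  obtain ⟨f₀, hf₀, hI⟩ := exists_prime_and_discriminantIdeal_eq_span k n hd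
  obtain ⟨Δ₀, hΔ₀, hIZ⟩ := exists_prime_and_discriminantIdeal_eq_span ℤ n hd
  have hspan : (Ideal.span {f₀}).IsHomogeneous (homogeneousSubmodule _ k) :=
    hI ▸ discriminantIdeal_isHomogeneous k n d
  have hZ := zeroLocus_eq_compl_nonsingularLocus hI
  refine ⟨?_, ?_, ?_, fun f Δ hf hΔ => ?_⟩
  · exact hZ ▸ isIrreducibleDivisor_zeroLocus hf₀ hspan (not_irrelevant_le_span_singleton hf₀)
  · exact ⟨f₀, hf₀.irreducible, exists_isHomogeneous_of_isHomogeneous_span hspan, hZ⟩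
  · exact ⟨Δ₀, hΔ₀.irreducible, fun K _ _ _ c _ =>
      aeval_eq_zero_iff_not_isNonsingularHypersurface hIZ c⟩
  · exact exists_map_eq_C_mul_pow hf.irreducible.prime
      (discriminantIdeal_eq_span_of_isDefiningEquation hn hf₀ hI hf)
      (discriminantIdeal_eq_span_of_isDiscriminant hn hΔ₀ hIZ hΔ)

theorem theorem3p3 {k : Type u} [Field k] [IsAlgClosed k] (p : ℕ) [CharP k p] (n d : ℕ)
    (hn : 1 ≤ n) (hd : 1 ≤ d) (hpd : p ∣ d) :
    IsIrreducibleDivisor (nonsingularLocus k n d)ᶜ ∧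
    (∃ f : MvPolynomial (DegreeExponent n d) k,
      IsDefiningEquation f (nonsingularLocus k n d)ᶜ) ∧
    (∃ Δ : MvPolynomial (DegreeExponent n d) ℤ, IsDiscriminant.{u} Δ) ∧
    ∀ (f : MvPolynomial (DegreeExponent n d) k) (Δ : MvPolynomial (DegreeExponent n d) ℤ),
      IsDefiningEquation f (nonsingularLocus k n d)ᶜ → IsDiscriminant.{u} Δ →
        ∃ (e : ℕ) (c : k), 1 ≤ e ∧ c ≠ 0 ∧
          MvPolynomial.map (Int.castRingHom k) Δ = MvPolynomial.C c * f ^ e := by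
  have hp : p.Prime := (CharP.char_is_prime_or_zero k p).resolve_right
    (ne_zero_of_dvd_ne_zero (Nat.one_le_iff_ne_zero.1 hd) hpd)
  exact theorem3p3_general n d hn (hp.two_le.trans (Nat.le_of_dvd hd hpd))
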